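/- **Resource calculus.** Fix a countably infinite set of variables. Resource terms $s$ and resource monomials $\bar t$ are given by $s ::= x \mid \lambda x.s \mid \langle s\rangle\bar t$ and $\bar t ::= [s_1,\dots,s_r]$ ($r\ge 0$), where terms are taken up to $\alpha$-equivalence and monomials are finite multisets. Below, $E$ denotes either the set of all resource terms or the set of all resource monomials (the same choice throughout), and $\mathbb N[E]$ the set of finite formal sums of elements of $E$; the support of a sum is the set of its summands. Syntactic constructs are extended to finite sums by multilinearity. The multilinear substitution $\partial_x(e,\bar u)$ of $\bar u=[u_1,\dots,u_n]$ for $x$ in $e$ is the finite sum, over all bijections from $\{1,\dots,n\}$ to the set of free occurrences of $x$ in $e$, of the result of replacing (without capture) each of these occurrences by the associated $u_i$; it is $0$ if $x$ does not occur exactly $n$ times in $e$. It is extended to finite sums bilinearly. *Parallel reduction* $\Rightarrow$ and, for $b\in\mathbb N$, *$b$-boundedly nested parallel reduction* $\Rightarrow_b$ are relations between expressions and finite sums, inductively defined by: - $x\Rightarrow_b x$; - $\lambda x.s\Rightarrow_b\lambda x.\sigma'$ if $s\Rightarrow_b\sigma'$; - $\langle s\rangle\bar t\Rightarrow_b\langle\sigma'\rangle\bar\tau'$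 if $s\Rightarrow_b\sigma'$ and $\bar t\Rightarrow_b\bar\tau'$; - $[s_1,\dots,s_r]\Rightarrow_b[\sigma'_1,\dots,\sigma'_r]$ if $s_i\Rightarrow_b\sigma'_i$ for all $i$; - $\langle\lambda x.s\rangle\bar t\Rightarrow_b\partial_x(\sigma',\bar\tau')$ if $b\ge1$, $s\Rightarrow_{b-1}\sigma'$ and $\bar t\Rightarrow_{b-1}\bar\tau'$; and $\Rightarrow$ is defined by the same rules without the indices and without the condition $b\ge1$. **Structures.** A *$\Rightarrow$-reduction structure* is a set $\mathfrak E$ of subsets of $E$, each with finitely many free variables altogether, which contains all finite subsets, is closed under finite unions and under taking subsets, and is such that if $\mathcal E\in\mathfrak E$ then the set of all $e'$ in the support of some $\varepsilon'$ with $e\Rightarrow\varepsilon'$ or $\varepsilon'=e$, for some $e\in\mathcal E$, is in $\mathfrak E$. **Vectors.** Let $S$ be a commutative semiring. A *resource vector* is a family $\varepsilon\in S^E$ whose support has finitely many free variables altogether. A family $(\varepsilon_i)_{i\in I}$ of finite sums (in particular, of expressions) is *summable* if each $e\in E$ is in the support of $\varepsilon_i$ for finitely many $i$ only; then $\sum_i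 a_i\varepsilon_i\in S^E$ is defined coefficientwise for all scalars $a_i\in S$. For a set $\mathfrak E$ as above, write $\varepsilon\rightsquigarrow_{\mathfrak E}\varepsilon'$ if there are $b\in\mathbb N$, $\mathcal E\in\mathfrak E$, scalars $(a_i)_{i\in I}$, a summable family $(e_i)_{i\in I}$ of expressions that have finitely many free variables altogether, and a summable family $(\varepsilon'_i)_{i\in I}$ of finite sums, such that $\varepsilon=\sum_i a_i e_i$, $\varepsilon'=\sum_i a_i\varepsilon'_i$ and, for all $i\in I$, $$e_i\in\mathcal E\quad\text{and}\quad(e_i\Rightarrow_b\varepsilon'_i\ \text{ or }\ \varepsilon'_i=e_i).\tag{1}$$ **Lemma.** Assume that $S$ has the additive splitting property: whenever $a_1+a_2=b_1+b_2$ in $S$ there are $c_{i,j}\in S$ ($i,j\in\{1,2\}$) with $a_i=c_{i,1}+c_{i,2}$ and $b_j=c_{1,j}+c_{2,j}$. Let $\mathfrak E$ be a $\Rightarrow$-reduction structure. For every finite set $K$ and all resource vectors $\varepsilon$ and $(\varepsilon'_k)_{k\in K}$ with $\varepsilon\rightsquigarrow_{\mathfrak E}\varepsilon'_k$ for all $k\in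 K$, there is a resource vector $\varepsilon''$ such that $\varepsilon'_k\rightsquigarrow_{\mathfrak E}\varepsilon''$ for all $k\in K$. The same holds if, in the definition of $\rightsquigarrow_{\mathfrak E}$, condition (1) is replaced by: ($e_i\in\mathcal E$ and $e_i\Rightarrow_b\varepsilon'_i$) or $\varepsilon'_i=e_i$. -/

import Mathlib

/-! ## The resource lambda-calculus

Resource terms `s ::= x | λx.s | ⟨s⟩ t̄`, where `t̄` is a finite multiset of resource terms (a resource
monomial), are taken up to renaming of bound variables.  We represent them by de Bruijn indices:
a variable is a natural number, and an index `i` met under `d` abstractions denotes the free variable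
`i - d` if `d ≤ i`, and is bound otherwise.  -/

namespace Resource

/-- One layer of term constructors, with subterms in `α`. -/
inductive TermF (α : Type) : Type
  | var (n : ℕ) : TermF α
  | lam (s : α) : TermF α
  | app (s : α) (t : Multiset α) : TermF α

namespace TermF

/-- The action of a function on the immediate subterms. -/
def map {α β : Type} (f : α → β) : TermF α → TermF β
  | var n => var n
  | lam s => lam (f s)
  | app s t => app (f s) (t.map f)

instance : Functor TermF where
  map := map

/-- Shapes of a layer of constructors, where the argument of an application is listed in some order. -/
inductive Shape : Type
  | var (n : ℕ) : Shape
  | lam : Shape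
  | app (n : ℕ) : Shape

/-- Positions of the immediate subterms in a shape. -/
def Shape.Pos : Shape → Type
  | var _ => Empty
  | lam => Unit
  | app n => Option (Fin n)

/-- `TermF` is a quotient of a polynomial functor, so that it has an initial algebra. -/
noncomputable instance : QPF TermF where
  P := ⟨Shape, Shape.Pos⟩
  abs := fun {_} x => match x with
    | ⟨.var n, _⟩ => var n
    | ⟨.lam, f⟩ => lam (f ())
    | ⟨.app _, f⟩ => app (f none) (List.ofFn fun i => f (some i) : List _)
  repr := fun {_} x => match x with
    | var n => ⟨.var n, fun i => i.elim⟩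
    | lam s => ⟨.lam, fun _ => s⟩
    | app s t => ⟨.app t.toList.length, fun i => i.elim s t.toList.get⟩
  abs_repr := by
    rintro α (n | s | ⟨s, t⟩)
    · rfl
    · rfl
    · exact congrArg (TermF.app s)
        ((congrArg _ (List.ofFn_get t.toList)).trans (Multiset.coe_toList t))
  abs_map := by
    rintro α β f ⟨n | _ | n, g⟩
    · rfl
    · rfl
    · simp [PFunctor.map, Functor.map, TermF.map, Function.comp_def, List.map_ofFn]

end TermF

/-- Resource terms: the initial algebra of `TermF`, that is, the inductive type with constructors
`var`, `lam` and `app`, the argument of `app` being a finite multiset of terms. -/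
def Term : Type := QPF.Fix TermF

/-- Resource monomials: finite multisets of resource terms. -/
abbrev Mon : Type := Multiset Term

/-- Finite formal sums of elements of `X`, i.e. elements of the free commutative monoid `ℕ[X]`,
given as finite multisets of summands.  So `0` is the empty sum, `σ + τ` is the sum, `{e}` is the sum with
only summand `e`, `e ∈ σ` says that `e` is in the support of `σ`, and `Multiset.count e σ` is the
coefficient of `e` in `σ`. -/
abbrev FinSum (X : Type) : Type := Multiset X

namespace Term

/-- The variable of index `n`. -/
noncomputable def var (n : ℕ) : Term := QPF.Fix.mk (TermF.var n)

/-- The abstraction of the variable of index `0` in `s`. -/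
noncomputable def lam (s : Term) : Term := QPF.Fix.mk (TermF.lam s : TermF (QPF.Fix TermF))

/-- The application of `s` to the monomial `t`. -/
noncomputable def app (s : Term) (t : Mon) : Term :=
  QPF.Fix.mk (TermF.app s t : TermF (QPF.Fix TermF))

/-- Iteration over terms. -/
noncomputable def iter {α : Type} (g : TermF α → α) : Term → α := QPF.Fix.rec g

theorem iter_var {α : Type} (g : TermF α → α) (n : ℕ) : iter g (var n) = g (.var n) :=
  QPF.Fix.rec_eq g _

theorem iter_lam {α : Type} (g : TermF α → α) (s : Term) : iter g (lam s) = g (.lam (iter g s)) :=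
  QPF.Fix.rec_eq g _

theorem iter_app {α : Type} (g : TermF α → α) (s : Term) (t : Mon) :
    iter g (app s t) = g (.app (iter g s) (t.map (iter g))) :=
  QPF.Fix.rec_eq g _

theorem induction {p : Term → Prop} (var : ∀ n, p (var n)) (lam : ∀ s, p s → p (lam s))
    (app : ∀ s t, p s → (∀ u ∈ t, p u) → p (app s t)) (s : Term) : p s := by
  refine QPF.Fix.ind p ?_ s
  rintro x ⟨u, rfl⟩
  rcases u with n | s | ⟨s, t⟩
  · exact var n
  · exact lam s.1 s.2
  · refine app s.1 (t.map Subtype.val) s.2 fun u hu => ?_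
    obtain ⟨v, -, rfl⟩ := Multiset.mem_map.1 hu
    exact v.2

/-- The free variables of a term. -/
noncomputable def fv : Term → Set ℕ := iter fun
  | .var n => {n}
  | .lam V => {n | n + 1 ∈ V}
  | .app V W => {n | n ∈ V ∨ ∃ U ∈ W, n ∈ U}

/-- The extension of a renaming of the free variables to the body of an abstraction. -/
def liftRen (f : ℕ → ℕ) : ℕ → ℕ
  | 0 => 0
  | n + 1 => f n + 1

/-- Renaming of the free variables of a term. -/
noncomputable def rename (f : ℕ → ℕ) (s : Term) : Term :=
  iter (α := (ℕ → ℕ) → Term) (fun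
    | .var n => fun f => var (f n)
    | .lam s => fun f => lam (s (liftRen f))
    | .app s t => fun f => app (s f) (t.map fun u => u f)) s f

/-- Shifting of all free variables by one: `s` seen in the scope of one more abstraction. -/
noncomputable def shift : Term → Term := rename Nat.succ

end Term

/-! Syntactic constructors, extended to finite sums by multilinearity. -/

/-- `λ(∑ sᵢ) = ∑ λ sᵢ`. -/
noncomputable def lamSum (σ : FinSum Term) : FinSum Term := σ.map Term.lam

/-- `⟨∑ sᵢ⟩ (∑ t̄ⱼ) = ∑ ⟨sᵢ⟩ t̄ⱼ`. -/
noncomputable def appSum (σ : FinSum Term) (τ : FinSum Mon) : FinSum Term :=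
  σ.bind fun s => τ.map fun t => Term.app s t

/-- `[∑ sᵢ] · (∑ t̄ⱼ) = ∑ [sᵢ] · t̄ⱼ`. -/
def consSum (σ : FinSum Term) (τ : FinSum Mon) : FinSum Mon :=
  σ.bind fun s => τ.map fun t => s ::ₘ t

/-- `[σ₁, …, σₙ]` for a multiset of finite sums of terms: the sum of all `[s₁, …, sₙ]` where each `sᵢ` is
a summand of `σᵢ`. -/
def bagSum (M : Multiset (FinSum Term)) : FinSum Mon := M.Sections

/-! ### Multilinear substitution -/

/-- Given operations `f` and `g`, from a monomial to a sum of terms and to a sum of monomials, the operation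
`u ↦ ∑ [f u_I] · (g u_J)`, where `(I, J)` ranges over the partitions in two parts of the set of
positions in the monomial `u`. -/
def consConv (f : Mon → FinSum Term) (g : Mon → FinSum Mon) (u : Mon) : FinSum Mon :=
  u.antidiagonal.bind fun p => consSum (f p.1) (g p.2)

theorem triple_swap (u : Mon) :
    (u.antidiagonal.bind fun p => p.2.antidiagonal.map fun q => (p.1, q.1, q.2)) =
      u.antidiagonal.bind fun p => p.2.antidiagonal.map fun q => (q.1, p.1, q.2) := by
  induction u using Multiset.induction_on with
  | empty => simp
  | cons a u ih =>
    have h1 := congrArg (Multiset.map fun x : Mon × Mon × Mon => (x.1, x.2.1, a ::ₘ x.2.2)) ih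
    have h2 := congrArg (Multiset.map fun x : Mon × Mon × Mon => (x.1, a ::ₘ x.2.1, x.2.2)) ih
    have h3 := congrArg (Multiset.map fun x : Mon × Mon × Mon => (a ::ₘ x.1, x.2.1, x.2.2)) ih
    simp only [Multiset.map_bind, Multiset.map_map, Function.comp_def] at h1 h2 h3
    simp only [Multiset.antidiagonal_cons, Multiset.add_bind, Multiset.bind_map, id,
      Multiset.map_add, Multiset.map_map, Function.comp_def, Multiset.bind_add, Prod.map_fst,
      Prod.map_snd]
    rw [h1, h2, h3]
    abel

instance : LeftCommutative consConv where
  left_comm f g h := by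
    funext u
    have key := congrArg (fun T => Multiset.bind T fun x : Mon × Mon × Mon =>
      (f x.1).bind fun s => (g x.2.1).bind fun t => (h x.2.2).map fun w => s ::ₘ t ::ₘ w)
      (triple_swap u)
    simp only [Multiset.bind_assoc, Multiset.bind_map] at key
    simp only [consConv, consSum, Multiset.map_bind, Multiset.map_map, Function.comp_def]
    have e1 : ∀ p : Mon × Mon, ((f p.1).bind fun s => p.2.antidiagonal.bind fun q =>
        (g q.1).bind fun t => (h q.2).map fun w => s ::ₘ t ::ₘ w) =
        p.2.antidiagonal.bind fun q => (f p.1).bind fun s =>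
        (g q.1).bind fun t => (h q.2).map fun w => s ::ₘ t ::ₘ w := fun p =>
      Multiset.bind_bind _ _
    have e2 : ∀ p : Mon × Mon, ((g p.1).bind fun t => p.2.antidiagonal.bind fun q =>
        (f q.1).bind fun s => (h q.2).map fun w => t ::ₘ s ::ₘ w) =
        p.2.antidiagonal.bind fun q => (f q.1).bind fun s =>
        (g p.1).bind fun t => (h q.2).map fun w => s ::ₘ t ::ₘ w := fun p => by
      rw [Multiset.bind_bind]
      refine Multiset.bind_congr fun q _ => ?_
      rw [Multiset.bind_bind]
      simp only [Multiset.cons_swap]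
    simp only [e1, e2, key]

/-- Given a multiset of operations `f₁, …, fᵣ` from monomials to sums of terms, the operation
`u ↦ ∑ [f₁ u_{I₁}, …, fᵣ u_{Iᵣ}]`, where `(I₁, …, Iᵣ)` ranges over the partitions in `r` parts (some of
which may be empty) of the set of positions in the monomial `u`. -/
def bagConv (F : Multiset (Mon → FinSum Term)) : Mon → FinSum Mon :=
  F.foldr consConv fun u => if Multiset.card u = 0 then {0} else 0

/-- Multilinear substitution `∂ₖ(s, u)` of the monomial `u` for the variable of index `k` in the term `s`:
the sum of the results of substituting bijectively the elements of `u` for the occurrences of this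
variable if there are exactly as many, and `0` otherwise.  The terms in `u` and the result live in the
context from which the variable of index `k` is removed, so that variables above `k` are lowered by one.
In the clause for a variable of index `k`, a monomial `u` of cardinality one is turned into the sum
with the same single element. -/
noncomputable def lsubst (s : Term) (k : ℕ) (u : Mon) : FinSum Term :=
  Term.iter (α := ℕ → Mon → FinSum Term) (fun
    | .var n => fun k u =>
        if n = k then if Multiset.card u = 1 then u else 0
        else if Multiset.card u = 0 then {Term.var (if n < k then n else n - 1)} else 0
    | .lam f => fun k u => lamSum (f (k + 1) (u.map Term.shift))
    | .app f F => fun k u =>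
        u.antidiagonal.bind fun p => appSum (f k p.1) (bagConv (F.map fun g => g k) p.2)) s k u

/-- Multilinear substitution in a monomial: the sum of the `[∂ₖ(s₁, u_{I₁}), …, ∂ₖ(sᵣ, u_{Iᵣ})]`, where
`(I₁, …, Iᵣ)` ranges over the partitions of the set of positions in `u`. -/
noncomputable def lsubstMon (t : Mon) (k : ℕ) (u : Mon) : FinSum Mon :=
  bagConv (t.map fun s => lsubst s k) u

theorem lsubst_var (n k : ℕ) (u : Mon) : lsubst (.var n) k u =
    if n = k then if Multiset.card u = 1 then u else 0
    else if Multiset.card u = 0 then {Term.var (if n < k then n else n - 1)} else 0 := by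
  rw [lsubst, Term.iter_var]

theorem lsubst_lam (s : Term) (k : ℕ) (u : Mon) :
    lsubst (.lam s) k u = lamSum (lsubst s (k + 1) (u.map Term.shift)) := by
  rw [lsubst, Term.iter_lam]; rfl

theorem lsubst_app (s : Term) (t : Mon) (k : ℕ) (u : Mon) : lsubst (.app s t) k u =
    u.antidiagonal.bind fun p => appSum (lsubst s k p.1) (lsubstMon t k p.2) := by
  rw [lsubst, Term.iter_app]
  simp only [Multiset.map_map, Function.comp_def]
  rfl

theorem lsubstMon_zero (k : ℕ) (u : Mon) :
    lsubstMon 0 k u = if Multiset.card u = 0 then {0} else 0 := by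
  simp [lsubstMon, bagConv]

theorem lsubstMon_cons (s : Term) (t : Mon) (k : ℕ) (u : Mon) : lsubstMon (s ::ₘ t) k u =
    u.antidiagonal.bind fun p => consSum (lsubst s k p.1) (lsubstMon t k p.2) := by
  simp [lsubstMon, bagConv, consConv]

/-- The reduct `∂ₓ(σ, τ)` of a redex: substitution for the variable of index `0`, extended to finite sums by
bilinearity. -/
noncomputable def lsubstSum (σ : FinSum Term) (τ : FinSum Mon) : FinSum Term :=
  σ.bind fun s => τ.bind fun t => lsubst s 0 t

/-! ### Parallel reductions

In the rules below, a monomial `[s₁, …, sᵣ]` and its reduct `[σ₁, …, σᵣ]` are given through the multiset `L`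
of the pairs `(sᵢ, σᵢ)`. -/

/-- Parallel resource reduction of terms. -/
inductive ParTerm : Term → FinSum Term → Prop
  | var (n : ℕ) : ParTerm (.var n) {.var n}
  | lam {s : Term} {σ : FinSum Term} : ParTerm s σ → ParTerm (.lam s) (lamSum σ)
  | app {s : Term} {σ : FinSum Term} (L : Multiset (Term × FinSum Term)) :
      ParTerm s σ → (∀ p ∈ L, ParTerm p.1 p.2) →
      ParTerm (.app s (L.map Prod.fst)) (appSum σ (bagSum (L.map Prod.snd)))
  | redex {s : Term} {σ : FinSum Term} (L : Multiset (Term × FinSum Term)) :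
      ParTerm s σ → (∀ p ∈ L, ParTerm p.1 p.2) →
      ParTerm (.app (.lam s) (L.map Prod.fst)) (lsubstSum σ (bagSum (L.map Prod.snd)))

/-- Parallel resource reduction of terms, where the nesting of fired redexes is bounded by `b`. -/
inductive BdTerm : ℕ → Term → FinSum Term → Prop
  | var (b n : ℕ) : BdTerm b (.var n) {.var n}
  | lam {b : ℕ} {s : Term} {σ : FinSum Term} : BdTerm b s σ → BdTerm b (.lam s) (lamSum σ)
  | app {b : ℕ} {s : Term} {σ : FinSum Term} (L : Multiset (Term × FinSum Term)) :
      BdTerm b s σ → (∀ p ∈ L, BdTerm b p.1 p.2) →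
      BdTerm b (.app s (L.map Prod.fst)) (appSum σ (bagSum (L.map Prod.snd)))
  | redex {b : ℕ} {s : Term} {σ : FinSum Term} (L : Multiset (Term × FinSum Term)) :
      BdTerm b s σ → (∀ p ∈ L, BdTerm b p.1 p.2) →
      BdTerm (b + 1) (.app (.lam s) (L.map Prod.fst)) (lsubstSum σ (bagSum (L.map Prod.snd)))

/-- The reduction of monomials induced by a reduction of terms: `[s₁, …, sᵣ] → [σ₁, …, σᵣ]` if `sᵢ → σᵢ` for
all `i`. -/
def MonRed (r : Term → FinSum Term → Prop) (t : Mon) (τ : FinSum Mon) : Prop :=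
  ∃ L : Multiset (Term × FinSum Term), (∀ p ∈ L, r p.1 p.2) ∧
    t = L.map Prod.fst ∧ τ = bagSum (L.map Prod.snd)

/-! ### Resource expressions -/

/-- The two kinds of resource expressions. -/
inductive Kind : Type
  | term : Kind
  | mon : Kind

/-- Resource expressions of a given kind: all resource terms, or all resource monomials. -/
def Expr : Kind → Type
  | .term => Term
  | .mon => Mon

/-- The free variables of a resource expression. -/
def fv : (κ : Kind) → Expr κ → Set ℕ
  | .term => Term.fv
  | .mon => fun t : Mon => {n | ∃ s ∈ t, n ∈ s.fv}

/-- Parallel resource reduction. -/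
def Par : (κ : Kind) → Expr κ → FinSum (Expr κ) → Prop
  | .term => ParTerm
  | .mon => MonRed ParTerm

/-- Parallel resource reduction with nesting of fired redexes bounded by `b`. -/
def Bd (b : ℕ) : (κ : Kind) → Expr κ → FinSum (Expr κ) → Prop
  | .term => BdTerm b
  | .mon => MonRed (BdTerm b)

/-! ### Resource structures -/

/-- The free variables of a set of expressions. -/
def fvSet {κ : Kind} (E : Set (Expr κ)) : Set ℕ := ⋃ e ∈ E, fv κ e

/-- The reflexive closure of a relation from expressions to finite sums. -/
def ReflStep {X : Type} (r : X → FinSum X → Prop) (e : X) (ε' : FinSum X) : Prop :=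
  r e ε' ∨ ε' = {e}

/-- The restriction of a relation to sources in `E`. -/
def RestrictTo {X : Type} (r : X → FinSum X → Prop) (E : Set X) (e : X) (ε' : FinSum X) : Prop :=
  e ∈ E ∧ r e ε'

/-- Resource structures: sets of resource supports (sets of expressions with finitely many free variables)
that contain all finite ones and are closed under finite unions and subsets. -/
structure IsResourceStructure {κ : Kind} (𝔈 : Set (Set (Expr κ))) : Prop where
  finite_fv : ∀ E ∈ 𝔈, (fvSet E).Finite
  finite_mem : ∀ E : Set (Expr κ), E.Finite → (fvSet E).Finite → E ∈ 𝔈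
  union_mem : ∀ E ∈ 𝔈, ∀ F ∈ 𝔈, E ∪ F ∈ 𝔈
  subset_mem : ∀ E ∈ 𝔈, ∀ F : Set (Expr κ), F ⊆ E → F ∈ 𝔈

/-- Reduction structures for a relation `r`: resource structures closed under taking the set of all
expressions in the supports of the `r`-reducts (reflexive closure) of the elements of a member. -/
structure IsReductionStructure {κ : Kind} (r : Expr κ → FinSum (Expr κ) → Prop)
    (𝔈 : Set (Set (Expr κ))) : Prop extends IsResourceStructure 𝔈 where
  reducts_mem : ∀ E ∈ 𝔈, {e' | ∃ e ∈ E, ∃ ε', ReflStep r e ε' ∧ e' ∈ ε'} ∈ 𝔈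

/-! ### Resource vectors and their reduction -/

/-- Resource vectors with coefficients in `S`: families of scalars indexed by expressions, with finitely many
free variables in the support. -/
def ResourceVector (S : Type*) [CommSemiring S] (κ : Kind) : Type _ :=
  {ε : Expr κ → S // (fvSet (Function.support ε)).Finite}

/-- Summability of a family of finite sums: each element is in finitely many of the supports. -/
def SummableFam {X I : Type} (ξ : I → FinSum X) : Prop := ∀ x, {i | x ∈ ξ i}.Finite

open Classical in
/-- The vector `∑ i, a i • ξ i`, meant for summable `ξ`: then each coefficient is a sum with finitely many
nonzero summands. -/
noncomputable def linComb {S : Type*} [CommSemiring S] {X I : Type} (a : I → S) (ξ : I → FinSum X) :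
    X → S :=
  fun x => ∑ᶠ i, a i * (Multiset.count x (ξ i) : S)

/-- The relation between resource vectors obtained from a relation `r` on expressions:
`∑ i, a i • e i` is related to `∑ i, a i • ε' i` whenever both families are summable, the expressions `e i` have
finitely many free variables altogether, and `r (e i) (ε' i)` for all `i`.  Expressions form a
countable set, so a summable family of expressions has a countable index set, and there is no restriction
in taking `I` in the lowest universe. -/
def SplitRed {S : Type*} [CommSemiring S] {κ : Kind} (r : Expr κ → FinSum (Expr κ) → Prop)
    (ε ε' : ResourceVector S κ) : Prop :=
  ∃ (I : Type) (a : I → S) (e : I → Expr κ) (η : I → FinSum (Expr κ)),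
    (fvSet (Set.range e)).Finite ∧
    SummableFam (fun i => ({e i} : FinSum (Expr κ))) ∧ ε.1 = linComb a (fun i => {e i}) ∧
    SummableFam η ∧ ε'.1 = linComb a η ∧
    ∀ i, r (e i) (η i)

/-- Boundedly nested parallel reduction of resource vectors along `𝔈`: for some `b` and some `E ∈ 𝔈`, all reduced
expressions belong to `E`, and each is reduced with nesting at most `b`, or unchanged. -/
def BdRed {S : Type*} [CommSemiring S] {κ : Kind} (𝔈 : Set (Set (Expr κ)))
    (ε ε' : ResourceVector S κ) : Prop :=
  ∃ b : ℕ, ∃ E ∈ 𝔈, SplitRed (RestrictTo (ReflStep (Bd b κ)) E) ε ε'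

/-- The variant of `BdRed` where the relation on expressions is restricted to `E` before its reflexive closure is
taken, so that expressions outside `E` may occur if they are left unchanged. -/
def BdRedLoose {S : Type*} [CommSemiring S] {κ : Kind} (𝔈 : Set (Set (Expr κ)))
    (ε ε' : ResourceVector S κ) : Prop :=
  ∃ b : ℕ, ∃ E ∈ 𝔈, SplitRed (ReflStep (RestrictTo (Bd b κ) E)) ε ε'

/-- The additive splitting property. -/
def AdditiveSplitting (S : Type*) [CommSemiring S] : Prop :=
  ∀ a₁ a₂ b₁ b₂ : S, a₁ + a₂ = b₁ + b₂ → ∃ c₁₁ c₁₂ c₂₁ c₂₂ : S,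
    a₁ = c₁₁ + c₁₂ ∧ a₂ = c₂₁ + c₂₂ ∧ b₁ = c₁₁ + c₂₁ ∧ b₂ = c₁₂ + c₂₂

end Resource

/-! The core is a confluence property of single expressions whose nesting bound does not depend on
the expression. Firing every redex would give a common reduct, but redexes may be nested arbitrarily
deep along an infinite family. Instead, given reducts `ξ k` of `x` with bounds `b k`, only the
redexes fired by some of these reductions are fired. The result is a sum `φ` to which every `ξ k`
reduces, summand by summand (`LinRed`), with nesting at most `2 ^ ∑ k, b k` (`commonReduct_term`).
When a redex is contracted, the substitution lemma `BdTerm.substRed` (from bounds `m` and `n` to `m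
+ n`) doubles the bound, but at least one `b k` has dropped by one, whence the exponential. The
substitution lemma itself rests on the commutation of multilinear substitutions, `substComm_lsubst`.

To pass to vectors, fix an expression `x`. The coefficients attached to `x` in each of the given
decompositions of `ε` add up to the same scalar `ε x`. By additive splitting these decompositions
have a common refinement (`AdditiveSplitting.exists_common_refinement`). Each index of the
refinement then carries one expression and one reduct of it for each `k`, hence a common reduct; the
sought vector is the combination of these common reducts.

Its summability is the remaining point. Multilinear substitution erases nothing, so a reduction of
nesting at most `b` divides sizes by at most `4 ^ b` (`BdTerm.size_le`). With finitely many free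
variables altogether, a given expression has finitely many antecedents (`finite_antecedents`).
Closure of `𝔈` under reducts provides both the member of `𝔈` and the bound on free variables needed
for the second reduction. -/

namespace Resource

/-! ### Constructors of terms and renamings -/

namespace Term

theorem mk_injective {x y : TermF (QPF.Fix TermF)} (h : QPF.Fix.mk x = QPF.Fix.mk y) : x = y := by
  simpa only [QPF.Fix.dest_mk] using congrArg QPF.Fix.dest h

theorem lam_injective {s t : Term} (h : lam s = lam t) : s = t :=
  TermF.lam.inj (mk_injective h)

theorem app_injective {s s' : Term} {t t' : Mon} (h : app s t = app s' t') : s = s' ∧ t = t' :=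
  TermF.app.inj (mk_injective h)

theorem var_ne_lam {n : ℕ} {s : Term} : var n ≠ lam s := fun h =>
  nomatch mk_injective h

theorem var_ne_app {n : ℕ} {s : Term} {t : Mon} : var n ≠ app s t := fun h =>
  nomatch mk_injective h

theorem lam_ne_app {r s : Term} {t : Mon} : lam r ≠ app s t := fun h =>
  nomatch mk_injective h

theorem exists_constructor (s : Term) :
    (∃ n, s = var n) ∨ (∃ t, s = lam t) ∨ ∃ t u, s = app t u := by
  induction s using Term.induction with
  | var n => exact .inl ⟨n, rfl⟩
  | lam s => exact .inr (.inl ⟨s, rfl⟩)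
  | app s t => exact .inr (.inr ⟨s, t, rfl⟩)

@[simp] theorem rename_var (f : ℕ → ℕ) (n : ℕ) : rename f (var n) = var (f n) := by
  rw [rename, iter_var]

@[simp] theorem rename_lam (f : ℕ → ℕ) (s : Term) :
    rename f (lam s) = lam (rename (liftRen f) s) := by
  rw [rename, iter_lam]; rfl

@[simp] theorem rename_app (f : ℕ → ℕ) (s : Term) (t : Mon) :
    rename f (app s t) = app (rename f s) (t.map (rename f)) := by
  rw [rename, iter_app]
  simp only [Multiset.map_map, Function.comp_def]
  rfl

theorem liftRen_comp (f g : ℕ → ℕ) : liftRen f ∘ liftRen g = liftRen (f ∘ g) := by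
  funext n
  cases n <;> rfl

theorem rename_rename (f g : ℕ → ℕ) (s : Term) : rename f (rename g s) = rename (f ∘ g) s := by
  induction s using Term.induction generalizing f g with
  | var n => simp
  | lam s ih => simp [ih, liftRen_comp]
  | app s t ihs iht =>
    simp only [rename_app, ihs, Multiset.map_map, Function.comp_apply]
    congr 1
    exact Multiset.map_congr rfl fun u hu => iht u hu f g

theorem shift_rename (f : ℕ → ℕ) (s : Term) :
    shift (rename f s) = rename (liftRen f) (shift s) := by
  rw [shift, rename_rename, rename_rename]
  rfl

theorem map_shift_map_rename (f : ℕ → ℕ) (u : Mon) :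
    (u.map (rename f)).map shift = (u.map shift).map (rename (liftRen f)) := by
  simp only [Multiset.map_map, Function.comp_def, shift_rename]

end Term

/-! ### Sums over the splittings of a multiset -/

section Antidiagonal

variable {α β γ : Type}

theorem antidiagonal_bind_swap (u : Multiset α) (F : Multiset α → Multiset α → Multiset β) :
    (u.antidiagonal.bind fun p => F p.1 p.2) = u.antidiagonal.bind fun p => F p.2 p.1 := by
  conv_lhs => rw [← Multiset.map_swap_antidiagonal, Multiset.bind_map]
  rfl

/-- Both sides sum over the splittings of `u` in three parts; the three summands of the induction
step tell which part receives the new element. -/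
theorem antidiagonal_bind_assoc (u : Multiset α)
    (F : Multiset α → Multiset α → Multiset α → Multiset β) :
    (u.antidiagonal.bind fun p => p.1.antidiagonal.bind fun q => F q.1 q.2 p.2) =
      u.antidiagonal.bind fun p => p.2.antidiagonal.bind fun q => F p.1 q.1 q.2 := by
  induction u using Multiset.induction_on generalizing F with
  | empty => simp
  | cons a u ih =>
    have h1 := ih fun x y z => F x y (a ::ₘ z)
    have h2 := ih fun x y z => F x (a ::ₘ y) z
    have h3 := ih fun x y z => F (a ::ₘ x) y z
    simp only [Multiset.antidiagonal_cons, Multiset.add_bind, Multiset.bind_map, id,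
      Multiset.bind_add, Prod.map_fst, Prod.map_snd, h1, h2, h3]
    abel

theorem antidiagonal_bind_left_comm (u : Multiset α)
    (F : Multiset α → Multiset α → Multiset α → Multiset β) :
    (u.antidiagonal.bind fun p => p.2.antidiagonal.bind fun q => F p.1 q.1 q.2) =
      u.antidiagonal.bind fun p => p.2.antidiagonal.bind fun q => F q.1 p.1 q.2 := by
  rw [← antidiagonal_bind_assoc, ← antidiagonal_bind_assoc u fun x y z => F y x z]
  exact Multiset.bind_congr fun p _ => antidiagonal_bind_swap p.1 fun x y => F x y p.2

/-- Both sides sum over the splittings of `u` in four parts, with the two middle parts exchanged.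
This regroups a double substitution in a compound expression component by component. -/
theorem antidiagonal_bind_interchange (u : Multiset α)
    (F : Multiset α → Multiset α → Multiset α → Multiset α → Multiset β) :
    (u.antidiagonal.bind fun p => p.1.antidiagonal.bind fun q => p.2.antidiagonal.bind fun r =>
        F q.1 q.2 r.1 r.2) =
      u.antidiagonal.bind fun p => p.1.antidiagonal.bind fun q => p.2.antidiagonal.bind fun r =>
        F q.1 r.1 q.2 r.2 := by
  rw [antidiagonal_bind_assoc u fun x y z => z.antidiagonal.bind fun r => F x y r.1 r.2,
    antidiagonal_bind_assoc u fun x y z => z.antidiagonal.bind fun r => F x r.1 y r.2]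
  exact Multiset.bind_congr fun p _ => antidiagonal_bind_left_comm p.2 fun x y z => F p.1 x y z

theorem antidiagonal_map (f : α → β) (u : Multiset α) :
    (u.map f).antidiagonal = u.antidiagonal.map fun p => (p.1.map f, p.2.map f) := by
  induction u using Multiset.induction_on with
  | empty => simp
  | cons a u ih => simp [ih]

/-- The splittings of a multiset whose first part is empty. -/
theorem antidiagonal_bind_of_card_left (u : Multiset α) (F : Multiset α → Multiset β) :
    (u.antidiagonal.bind fun p => if Multiset.card p.1 = 0 then F p.2 else 0) = F u := by
  induction u using Multiset.induction_on generalizing F with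
  | empty => simp
  | cons a u ih =>
    simp only [Multiset.antidiagonal_cons, Multiset.add_bind, Multiset.bind_map, id, Prod.map_fst,
      Prod.map_snd, ih fun v => F (a ::ₘ v)]
    simp

theorem antidiagonal_bind_of_card_right (u : Multiset α) (F : Multiset α → Multiset β) :
    (u.antidiagonal.bind fun p => if Multiset.card p.2 = 0 then F p.1 else 0) = F u := by
  rw [antidiagonal_bind_swap u fun x y => if Multiset.card y = 0 then F x else 0]
  exact antidiagonal_bind_of_card_left u F

theorem bind_ite_zero (m : Multiset α) (c : Prop) [Decidable c] (f : α → Multiset β) :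
    (m.bind fun a => if c then f a else 0) = if c then m.bind f else 0 := by
  split_ifs <;> simp

theorem ite_zero_bind (m : Multiset α) (c : Prop) [Decidable c] (f : α → Multiset β) :
    ((if c then m else 0).bind f) = if c then m.bind f else 0 := by
  split_ifs <;> simp

end Antidiagonal

/-! ### Commutation of multilinear substitution with renaming -/

/-- The index, once the variable of index `k` is removed from the context, of the variable of index
`n ≠ k`. -/
def lowerVar (k n : ℕ) : ℕ := if n < k then n else n - 1

theorem lowerVar_succ {k n : ℕ} (h : n ≠ k) : lowerVar (k + 1) (n + 1) = lowerVar k n + 1 := by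
  unfold lowerVar
  split_ifs <;> omega

theorem lsubst_var_self (k : ℕ) (u : Mon) :
    lsubst (.var k) k u = if Multiset.card u = 1 then u else 0 := by
  rw [lsubst_var, if_pos rfl]

theorem lsubst_var_of_ne {k n : ℕ} (h : n ≠ k) (u : Mon) :
    lsubst (.var n) k u = if Multiset.card u = 0 then {Term.var (lowerVar k n)} else 0 := by
  rw [lsubst_var, if_neg h]; rfl

/-- The renaming `f'` fixes the removed variable (`k` before, `k'` after), and acts like `f` on the
others. -/
structure Extends (f f' : ℕ → ℕ) (k k' : ℕ) : Prop where
  map_self : f' k = k'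
  map_ne : ∀ n, n ≠ k → f' n ≠ k'
  lower : ∀ n, n ≠ k → lowerVar k' (f' n) = f (lowerVar k n)

/-- This stability under abstraction is why renamings and indices are left free in the induction of
`map_rename_lsubst`. -/
theorem Extends.lift {f f' : ℕ → ℕ} {k k' : ℕ} (h : Extends f f' k k') :
    Extends (Term.liftRen f) (Term.liftRen f') (k + 1) (k' + 1) where
  map_self := by simp [Term.liftRen, h.map_self]
  map_ne n hn := by
    cases n with
    | zero => simp [Term.liftRen]
    | succ n => simpa [Term.liftRen] using h.map_ne n (by omega)
  lower n hn := by
    cases n with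
    | zero => simp [Term.liftRen, lowerVar]
    | succ n =>
      have hn' : n ≠ k := by omega
      simp only [Term.liftRen]
      rw [lowerVar_succ (h.map_ne n hn'), lowerVar_succ hn', h.lower n hn']

theorem map_rename_lsubstMon {f f' : ℕ → ℕ} {k k' : ℕ} {t : Mon}
    (h : ∀ s ∈ t, ∀ u : Mon, (lsubst s k u).map (Term.rename f) =
      lsubst (s.rename f') k' (u.map (Term.rename f))) (u : Mon) :
    (lsubstMon t k u).map (Multiset.map (Term.rename f)) =
      lsubstMon (t.map (Term.rename f')) k' (u.map (Term.rename f)) := by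
  induction t using Multiset.induction_on generalizing u with
  | empty => simp only [lsubstMon_zero, Multiset.map_zero, Multiset.card_map]; split_ifs <;> simp
  | cons s t ih =>
    have ht := ih fun r hr => h r (Multiset.mem_cons_of_mem hr)
    have hs := h s (Multiset.mem_cons_self s t)
    simp only [Multiset.map_cons, lsubstMon_cons, antidiagonal_map, consSum, Multiset.map_bind,
      Multiset.bind_map, Multiset.map_map, Function.comp_def, ← ht, ← hs]

theorem map_rename_lsubst {f f' : ℕ → ℕ} {k k' : ℕ} (h : Extends f f' k k') (s : Term) (u : Mon) :
    (lsubst s k u).map (Term.rename f) =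
      lsubst (s.rename f') k' (u.map (Term.rename f)) := by
  induction s using Term.induction generalizing f f' k k' u with
  | var n =>
    by_cases hn : n = k
    · subst hn
      rw [Term.rename_var, h.map_self, lsubst_var_self, lsubst_var_self, Multiset.card_map]
      split_ifs <;> simp
    · rw [Term.rename_var, lsubst_var_of_ne hn, lsubst_var_of_ne (h.map_ne n hn),
        Multiset.card_map, h.lower n hn]
      split_ifs <;> simp
  | lam s ih =>
    rw [Term.rename_lam, lsubst_lam, lsubst_lam, Term.map_shift_map_rename, ← ih h.lift]
    simp only [lamSum, Multiset.map_map, Function.comp_def, Term.rename_lam]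
  | app s t ihs iht =>
    have ht := map_rename_lsubstMon (t := t) fun r hr u => iht r hr h u
    simp only [Term.rename_app, lsubst_app, antidiagonal_map, appSum, Multiset.map_bind,
      Multiset.bind_map, Multiset.map_map, Function.comp_def, ← ht, ← ihs h]

/-- The renaming that makes room for a variable of index `k`. -/
def insertVar (k : ℕ) : ℕ → ℕ := Term.liftRen^[k] Nat.succ

theorem insertVar_succ (k : ℕ) : insertVar (k + 1) = Term.liftRen (insertVar k) :=
  Function.iterate_succ_apply' _ _ _

theorem insertVar_apply (k n : ℕ) : insertVar k n = if n < k then n else n + 1 := by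
  induction k generalizing n with
  | zero => rfl
  | succ k ih =>
    rw [insertVar_succ]
    cases n with
    | zero => rfl
    | succ n =>
      simp only [Term.liftRen, ih]
      split_ifs <;> omega

theorem insertVar_extends {j k : ℕ} (h : j ≤ k) :
    Extends (insertVar j) (insertVar j) k (k + 1) where
  map_self := by rw [insertVar_apply, if_neg (by omega)]
  map_ne n hn := by rw [insertVar_apply]; split_ifs <;> omega
  lower n hn := by simp only [insertVar_apply, lowerVar]; split_ifs <;> omega

theorem map_shift_lsubst (s : Term) (k : ℕ) (u : Mon) :
    (lsubst s k u).map Term.shift = lsubst s.shift (k + 1) (u.map Term.shift) :=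
  map_rename_lsubst (insertVar_extends (Nat.zero_le k)) s u

theorem map_shift_lsubstMon (t : Mon) (k : ℕ) (u : Mon) :
    (lsubstMon t k u).map (Multiset.map Term.shift) =
      lsubstMon (t.map Term.shift) (k + 1) (u.map Term.shift) :=
  map_rename_lsubstMon (fun s _ u => map_shift_lsubst s k u) u

/-! ### Substitution for a variable that does not occur -/

theorem lsubstMon_rename_of_forall {g : ℕ → ℕ} {k : ℕ} {t : Mon}
    (h : ∀ s ∈ t, ∀ u : Mon, lsubst (s.rename g) k u = if Multiset.card u = 0 then {s} else 0)
    (u : Mon) :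
    lsubstMon (t.map (Term.rename g)) k u = if Multiset.card u = 0 then {t} else 0 := by
  induction t using Multiset.induction_on generalizing u with
  | empty => rw [Multiset.map_zero, lsubstMon_zero]
  | cons s t ih =>
    rw [Multiset.map_cons, lsubstMon_cons]
    simp only [h s (Multiset.mem_cons_self s t), ih fun r hr => h r (Multiset.mem_cons_of_mem hr),
      consSum, ite_zero_bind, Multiset.singleton_bind]
    rw [antidiagonal_bind_of_card_left u fun v =>
      ((if Multiset.card v = 0 then {t} else 0 : FinSum Mon).map fun r => s ::ₘ r)]
    split_ifs <;> simp

/-- The substituted variable does not occur, and lowering the other variables undoes `g`. An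
arbitrary `g` is allowed because the induction passes to `liftRen g` under abstractions. -/
theorem lsubst_rename_of_notMem_range {g : ℕ → ℕ} {k : ℕ} (hg : ∀ n, g n ≠ k)
    (hl : ∀ n, lowerVar k (g n) = n) (s : Term) (u : Mon) :
    lsubst (s.rename g) k u = if Multiset.card u = 0 then {s} else 0 := by
  induction s using Term.induction generalizing g k u with
  | var n => rw [Term.rename_var, lsubst_var_of_ne (hg n), hl]
  | lam s ih =>
    rw [Term.rename_lam, lsubst_lam, ih, Multiset.card_map]
    · split_ifs <;> simp [lamSum]
    · rintro (_ | n)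
      · simp [Term.liftRen]
      · simpa [Term.liftRen] using hg n
    · rintro (_ | n)
      · simp [Term.liftRen, lowerVar]
      · rw [Term.liftRen, lowerVar_succ (hg n), hl]
  | app s t ihs iht =>
    rw [Term.rename_app, lsubst_app]
    simp only [ihs hg hl, lsubstMon_rename_of_forall fun r hr u => iht r hr hg hl u,
      appSum, ite_zero_bind, Multiset.singleton_bind]
    rw [antidiagonal_bind_of_card_left u fun v =>
      ((if Multiset.card v = 0 then {t} else 0 : FinSum Mon).map fun r => s.app r)]
    split_ifs <;> simp

theorem lsubst_insertVar (k : ℕ) (s : Term) (u : Mon) :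
    lsubst (s.rename (insertVar k)) k u = if Multiset.card u = 0 then {s} else 0 :=
  lsubst_rename_of_notMem_range
    (fun n => by rw [insertVar_apply]; split_ifs <;> omega)
    (fun n => by simp only [insertVar_apply, lowerVar]; split_ifs <;> omega) s u

/-! ### Commutation of multilinear substitutions -/

theorem bind_bind_comm {α β γ δ : Type} (m : Multiset α) (n : Multiset β) (l : Multiset γ)
    (f : α → β → γ → Multiset δ) :
    (m.bind fun a => n.bind fun b => l.bind fun c => f a b c) =
      l.bind fun c => m.bind fun a => n.bind fun b => f a b c := by
  rw [Multiset.bind_bind l m]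
  exact Multiset.bind_congr fun a _ => Multiset.bind_bind _ _

theorem bind_bind_bind {α β γ δ ζ : Type} (m : Multiset α) (n : Multiset β)
    (A : α → Multiset γ) (B : β → Multiset δ) (f : γ → δ → Multiset ζ) :
    ((m.bind A).bind fun c => (n.bind B).bind fun d => f c d) =
      m.bind fun a => n.bind fun b => (A a).bind fun c => (B b).bind fun d => f c d := by
  simp only [Multiset.bind_assoc]
  refine Multiset.bind_congr fun a _ => ?_
  rw [Multiset.bind_bind]

theorem card_of_mem_lsubstMon {t t' : Mon} {k : ℕ} {u : Mon} (h : t' ∈ lsubstMon t k u) :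
    Multiset.card t' = Multiset.card t := by
  induction t using Multiset.induction_on generalizing u t' with
  | empty =>
    rw [lsubstMon_zero] at h
    split_ifs at h <;> simp_all
  | cons s t ih =>
    simp only [lsubstMon_cons, consSum, Multiset.mem_bind, Multiset.mem_map] at h
    obtain ⟨p, -, a, -, b, hb, rfl⟩ := h
    rw [Multiset.card_cons, Multiset.card_cons, ih hb]

theorem lsubstMon_singleton (s : Term) (k : ℕ) (u : Mon) :
    lsubstMon {s} k u = (lsubst s k u).map fun r => {r} := by
  rw [← Multiset.cons_zero, lsubstMon_cons]
  simp only [lsubstMon_zero, consSum]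
  refine Eq.trans (Multiset.bind_congr fun p _ => ?_) (antidiagonal_bind_of_card_right u fun v =>
    (lsubst s k v).map fun r => ({r} : Mon))
  split_ifs
  · simp [Multiset.bind_singleton]
  · simp

/-- Substituting in a monomial, and then splitting the result, amounts to splitting the monomial
first. -/
theorem lsubstMon_bind_antidiagonal {β : Type} (t : Mon) (k : ℕ) (u : Mon)
    (F : Mon → Mon → Multiset β) :
    ((lsubstMon t k u).bind fun t' => t'.antidiagonal.bind fun p => F p.1 p.2) =
      t.antidiagonal.bind fun p => u.antidiagonal.bind fun q =>
        (lsubstMon p.1 k q.1).bind fun t₁ => (lsubstMon p.2 k q.2).bind fun t₂ => F t₁ t₂ := by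
  induction t using Multiset.induction_on generalizing u F with
  | empty =>
    simp only [lsubstMon_zero, Multiset.antidiagonal_zero, Multiset.singleton_bind, ite_zero_bind]
    rw [antidiagonal_bind_of_card_left u fun v => if Multiset.card v = 0 then F 0 0 else 0]
  | cons s t ih =>
    simp only [lsubstMon_cons, consSum, Multiset.bind_assoc, Multiset.bind_map,
      Multiset.antidiagonal_cons, Multiset.add_bind, id, Multiset.bind_add, Prod.map_fst,
      Prod.map_snd]
    -- The two goals correspond to `s` going to the second part, then to the first part.
    congr 1
    · have e : ∀ p : Mon × Mon, ((lsubst s k p.1).bind fun a => (lsubstMon t k p.2).bind fun t' =>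
          t'.antidiagonal.bind fun q => F q.1 (a ::ₘ q.2)) =
          t.antidiagonal.bind fun r => p.2.antidiagonal.bind fun q => (lsubst s k p.1).bind fun a =>
            (lsubstMon r.1 k q.1).bind fun t₁ => (lsubstMon r.2 k q.2).bind fun t₂ =>
              F t₁ (a ::ₘ t₂) := fun p => by
        refine (Multiset.bind_congr fun a _ => ih p.2 fun x y => F x (a ::ₘ y)).trans ?_
        rw [Multiset.bind_bind]
        exact Multiset.bind_congr fun r _ => Multiset.bind_bind _ _
      simp only [e]
      rw [Multiset.bind_bind]
      refine Multiset.bind_congr fun r _ => ?_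
      rw [antidiagonal_bind_left_comm u fun x y z => (lsubst s k x).bind fun a =>
            (lsubstMon r.1 k y).bind fun t₁ => (lsubstMon r.2 k z).bind fun t₂ =>
              F t₁ (a ::ₘ t₂)]
      refine Multiset.bind_congr fun p _ => ?_
      rw [Multiset.bind_bind]
      refine Multiset.bind_congr fun q _ => ?_
      rw [Multiset.bind_bind]
    · have e : ∀ p : Mon × Mon, ((lsubst s k p.1).bind fun a => (lsubstMon t k p.2).bind fun t' =>
          t'.antidiagonal.bind fun q => F (a ::ₘ q.1) q.2) =
          t.antidiagonal.bind fun r => p.2.antidiagonal.bind fun q => (lsubst s k p.1).bind fun a =>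
            (lsubstMon r.1 k q.1).bind fun t₁ => (lsubstMon r.2 k q.2).bind fun t₂ =>
              F (a ::ₘ t₁) t₂ := fun p => by
        refine (Multiset.bind_congr fun a _ => ih p.2 fun x y => F (a ::ₘ x) y).trans ?_
        rw [Multiset.bind_bind]
        exact Multiset.bind_congr fun r _ => Multiset.bind_bind _ _
      simp only [e]
      rw [Multiset.bind_bind]
      refine Multiset.bind_congr fun r _ => ?_
      rw [← antidiagonal_bind_assoc u fun x y z => (lsubst s k x).bind fun a =>
            (lsubstMon r.1 k y).bind fun t₁ => (lsubstMon r.2 k z).bind fun t₂ =>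
              F (a ::ₘ t₁) t₂]

/-- Commutation of the substitutions `S`, defined on some kind of expressions, with substitutions
in terms. -/
def SubstComm {X : Type} (S : X → ℕ → Mon → FinSum X) (x : X) : Prop :=
  ∀ (j k : ℕ) (t u : Mon), j ≤ k →
    ((S x j t).bind fun r => S r k u) =
      u.antidiagonal.bind fun p => (S x (k + 1) (p.1.map (Term.rename (insertVar j)))).bind fun x' =>
        (lsubstMon t k p.2).bind fun t' => S x' j t'

/-- The operation `op` on expressions commutes with the substitutions `SX`, `SY` and `SZ`. -/
def SubstOp {X Y Z : Type} (op : X → Y → Z) (SX : X → ℕ → Mon → FinSum X)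
    (SY : Y → ℕ → Mon → FinSum Y) (SZ : Z → ℕ → Mon → FinSum Z) : Prop :=
  ∀ x y k u, SZ (op x y) k u =
    u.antidiagonal.bind fun p => (SX x k p.1).bind fun a => (SY y k p.2).map fun b => op a b

theorem substOp_app : SubstOp Term.app lsubst lsubstMon lsubst := lsubst_app

theorem substOp_cons : SubstOp Multiset.cons lsubst lsubstMon lsubstMon := lsubstMon_cons

/-- Both sides expand to sums over the splittings of `t` in two parts and of `u` in four. On the
left, `u` is first shared between `x` and `y`, then each share is divided between the expression and
its part of `t`; on the right the order is reversed. `antidiagonal_bind_interchange` matches the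
two. -/
theorem SubstComm.op {X Y Z : Type} {op : X → Y → Z} {SX : X → ℕ → Mon → FinSum X}
    {SY : Y → ℕ → Mon → FinSum Y} {SZ : Z → ℕ → Mon → FinSum Z} (hop : SubstOp op SX SY SZ)
    {x : X} {y : Y} (hx : SubstComm SX x) (hy : SubstComm SY y) : SubstComm SZ (op x y) := by
  intro j k t u hjk
  replace hop : ∀ x y k u, SZ (op x y) k u = u.antidiagonal.bind fun p =>
    (SX x k p.1).bind fun a => (SY y k p.2).map fun b => op a b := hop
  have lhs : ((SZ (op x y) j t).bind fun r => SZ r k u) =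
      t.antidiagonal.bind fun p => u.antidiagonal.bind fun q =>
        ((SX x j p.1).bind fun r => SX r k q.1).bind fun a =>
          ((SY y j p.2).bind fun r => SY r k q.2).map fun b => op a b := by
    rw [hop]
    simp only [hop, Multiset.bind_assoc, Multiset.bind_map, Multiset.map_bind]
    refine Multiset.bind_congr fun p _ => ?_
    have e : ∀ a : X, ((SY y j p.2).bind fun b => u.antidiagonal.bind fun q =>
        (SX a k q.1).bind fun a' => (SY b k q.2).map fun b' => op a' b') =
        u.antidiagonal.bind fun q => (SX a k q.1).bind fun a' =>
          (SY y j p.2).bind fun b => (SY b k q.2).map fun b' => op a' b' := fun a => by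
      rw [Multiset.bind_bind]
      exact Multiset.bind_congr fun q _ => Multiset.bind_bind _ _
    simp only [e]
    rw [Multiset.bind_bind]
  have rhs : (u.antidiagonal.bind fun p =>
      (SZ (op x y) (k + 1) (p.1.map (Term.rename (insertVar j)))).bind fun z' =>
        (lsubstMon t k p.2).bind fun t' => SZ z' j t') =
      t.antidiagonal.bind fun p => u.antidiagonal.bind fun q =>
        q.1.antidiagonal.bind fun v => q.2.antidiagonal.bind fun w =>
        (SX x (k + 1) (v.1.map (Term.rename (insertVar j)))).bind fun x' =>
        (SY y (k + 1) (v.2.map (Term.rename (insertVar j)))).bind fun y' =>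
        (lsubstMon p.1 k w.1).bind fun t₁ => (lsubstMon p.2 k w.2).bind fun t₂ =>
        (SX x' j t₁).bind fun a => (SY y' j t₂).map fun b => op a b := by
    rw [Multiset.bind_bind t.antidiagonal]
    refine Multiset.bind_congr fun q _ => ?_
    rw [hop, antidiagonal_map]
    simp only [Multiset.bind_assoc, Multiset.bind_map]
    rw [Multiset.bind_bind t.antidiagonal]
    refine Multiset.bind_congr fun v _ => ?_
    have e : ∀ x' y', ((lsubstMon t k q.2).bind fun t' => SZ (op x' y') j t') =
        t.antidiagonal.bind fun p => q.2.antidiagonal.bind fun w =>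
          (lsubstMon p.1 k w.1).bind fun t₁ => (lsubstMon p.2 k w.2).bind fun t₂ =>
          (SX x' j t₁).bind fun a => (SY y' j t₂).map fun b => op a b := fun x' y' => by
      simp only [hop x' y' j]
      exact lsubstMon_bind_antidiagonal t k q.2 fun t₁ t₂ =>
        (SX x' j t₁).bind fun a => (SY y' j t₂).map fun b => op a b
    simp only [e]
    rw [bind_bind_comm]
    refine Multiset.bind_congr fun p _ => ?_
    rw [bind_bind_comm]
  rw [lhs, rhs]
  refine Multiset.bind_congr fun p _ => ?_
  rw [antidiagonal_bind_interchange u fun v₁ v₂ w₁ w₂ =>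
        (SX x (k + 1) (v₁.map (Term.rename (insertVar j)))).bind fun x' =>
        (SY y (k + 1) (v₂.map (Term.rename (insertVar j)))).bind fun y' =>
        (lsubstMon p.1 k w₁).bind fun t₁ => (lsubstMon p.2 k w₂).bind fun t₂ =>
        (SX x' j t₁).bind fun a => (SY y' j t₂).map fun b => op a b]
  refine Multiset.bind_congr fun q _ => ?_
  rw [hx j k p.1 q.1 hjk, hy j k p.2 q.2 hjk]
  simp only [Multiset.bind_assoc, Multiset.map_bind]
  refine Multiset.bind_congr fun v _ => ?_
  simp only [Multiset.bind_bind _ q.2.antidiagonal]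
  refine Multiset.bind_congr fun w _ => ?_
  refine Multiset.bind_congr fun x' _ => ?_
  rw [Multiset.bind_bind (SY y (k + 1) _)]
  refine Multiset.bind_congr fun t₁ _ => ?_
  rw [Multiset.bind_bind (SX x' j t₁)]
  refine Multiset.bind_congr fun y' _ => ?_
  rw [Multiset.bind_bind (SX x' j t₁)]

/-! ### Base cases of the commutation: the empty monomial and variables. -/

theorem lsubstMon_bind_ite_card {β : Type} (t : Mon) (k : ℕ) (u : Mon) (n : ℕ)
    (F : Mon → Multiset β) :
    ((lsubstMon t k u).bind fun t' => if Multiset.card t' = n then F t' else 0) =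
      if Multiset.card t = n then (lsubstMon t k u).bind F else 0 := by
  rw [← bind_ite_zero]
  exact Multiset.bind_congr fun t' ht => by rw [card_of_mem_lsubstMon ht]

theorem lsubstMon_bind_ite_card_zero {β : Type} (t : Mon) (k : ℕ) (u : Mon) (B : Multiset β) :
    ((lsubstMon t k u).bind fun t' => if Multiset.card t' = 0 then B else 0) =
      if Multiset.card t = 0 then if Multiset.card u = 0 then B else 0 else 0 := by
  rw [lsubstMon_bind_ite_card]
  split_ifs with ht hu
  · rw [Multiset.card_eq_zero.1 ht, lsubstMon_zero, if_pos hu, Multiset.singleton_bind]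
  · rw [Multiset.card_eq_zero.1 ht, lsubstMon_zero, if_neg hu, Multiset.zero_bind]
  · rfl

theorem substComm_lsubstMon_zero : SubstComm lsubstMon 0 := by
  intro j k t u _
  simp only [lsubstMon_zero, ite_zero_bind, Multiset.singleton_bind, Multiset.card_map,
    lsubstMon_bind_ite_card_zero]
  rw [antidiagonal_bind_of_card_left u fun v =>
    if Multiset.card t = 0 then if Multiset.card v = 0 then {0} else 0 else 0]

theorem substComm_var (n : ℕ) : SubstComm lsubst (.var n) := by
  intro j k t u hjk
  rcases eq_or_ne n j with rfl | hnj
  -- Case `n = j`: both sides vanish unless `t` is a singleton `[s]`, and then give `∂ₖ(s, u)`. On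
  -- the right only the splitting with empty first part survives.
  · simp only [lsubst_var_self, lsubst_var_of_ne (show n ≠ k + 1 by omega), ite_zero_bind,
      Multiset.card_map, Multiset.singleton_bind]
    have hl : lowerVar (k + 1) n = n := if_pos (by omega)
    rw [antidiagonal_bind_of_card_left u fun v => (lsubstMon t k v).bind fun t' =>
      lsubst (.var (lowerVar (k + 1) n)) n t', hl]
    simp only [lsubst_var_self]
    rw [lsubstMon_bind_ite_card t k u 1 fun t' => t']
    split_ifs with ht
    · obtain ⟨s, rfl⟩ := Multiset.card_eq_one.1 ht
      rw [lsubstMon_singleton, Multiset.singleton_bind, Multiset.bind_map,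
        Multiset.bind_singleton, Multiset.map_id']
    · rfl
  rcases eq_or_ne n (k + 1) with rfl | hnk
  -- Case `n = k + 1`: both sides require `t` empty and `u` a singleton. On the right its element
  -- was renamed by `insertVar j`, so the variable `j` does not occur in it and `lsubst_insertVar`
  -- returns it unchanged.
  · have hl : lowerVar j (k + 1) = k := if_neg (by omega)
    simp only [lsubst_var_self, lsubst_var_of_ne hnj, hl, ite_zero_bind, Multiset.card_map,
      Multiset.singleton_bind, Multiset.bind_map, lsubst_insertVar, lsubstMon_bind_ite_card_zero,
      bind_ite_zero]
    refine ((Multiset.bind_congr fun p _ => ?_).trans (antidiagonal_bind_of_card_right u fun v =>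
      if Multiset.card t = 0 then if Multiset.card v = 1 then v else 0 else 0)).symm
    rw [show p.1.bind singleton = p.1 from (Multiset.bind_singleton p.1 id).trans (Multiset.map_id _)]
    split_ifs <;> rfl
  · have h1 : lowerVar j n ≠ k := by unfold lowerVar; split_ifs <;> omega
    have h2 : lowerVar (k + 1) n ≠ j := by unfold lowerVar; split_ifs <;> omega
    have h3 : lowerVar k (lowerVar j n) = lowerVar j (lowerVar (k + 1) n) := by
      unfold lowerVar; split_ifs <;> omega
    simp only [lsubst_var_of_ne hnj, lsubst_var_of_ne hnk, lsubst_var_of_ne h1,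
      lsubst_var_of_ne h2, ite_zero_bind, Multiset.card_map, Multiset.singleton_bind,
      lsubstMon_bind_ite_card_zero, h3]
    rw [antidiagonal_bind_of_card_left u fun v => if Multiset.card t = 0 then
      if Multiset.card v = 0 then {Term.var (lowerVar j (lowerVar (k + 1) n))} else 0 else 0]

theorem substComm_lsubst (s : Term) : SubstComm lsubst s := by
  induction s using Term.induction with
  | var n => exact substComm_var n
  | lam s ih =>
    intro j k t u hjk
    have := ih (j + 1) (k + 1) (t.map Term.shift) (u.map Term.shift) (by omega)
    simp only [lsubst_lam, lamSum, Multiset.bind_map, antidiagonal_map, ← map_shift_lsubstMon,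
      Term.map_shift_map_rename, ← insertVar_succ, ← Multiset.map_bind] at this ⊢
    exact congrArg (Multiset.map Term.lam) this
  | app s t ihs iht =>
    refine ihs.op substOp_app ?_
    induction t using Multiset.induction_on with
    | empty => exact substComm_lsubstMon_zero
    | cons r t ih =>
      exact (iht r (Multiset.mem_cons_self r t)).op substOp_cons
        (ih fun v hv => iht v (Multiset.mem_cons_of_mem hv))

/-! ### Linear extension of a relation -/

/-- The relation between finite sums obtained by adding up instances of `r`. -/
inductive LinRed {X Y : Type} (r : X → FinSum Y → Prop) : FinSum X → FinSum Y → Prop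
  | zero : LinRed r 0 0
  | add {x : X} {φ : FinSum Y} {ξ : FinSum X} {ψ : FinSum Y} :
      r x φ → LinRed r ξ ψ → LinRed r (x ::ₘ ξ) (φ + ψ)

namespace LinRed

variable {X Y Z X' Y' Z' : Type} {r : X → FinSum X' → Prop}

theorem single {x : X} {φ : FinSum X'} (h : r x φ) : LinRed r {x} φ := by
  simpa using add h zero

theorem append {ξ ξ' : FinSum X} {φ φ' : FinSum X'} (h : LinRed r ξ φ) (h' : LinRed r ξ' φ') :
    LinRed r (ξ + ξ') (φ + φ') := by
  induction h with
  | zero => simpa using h'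
  | add hx _ ih => simpa only [Multiset.cons_add, add_assoc] using add hx ih

theorem bind {m : Multiset Z} {f : Z → FinSum X} {g : Z → FinSum X'}
    (h : ∀ a ∈ m, LinRed r (f a) (g a)) : LinRed r (m.bind f) (m.bind g) := by
  induction m using Multiset.induction_on with
  | empty => exact zero
  | cons a m ih =>
    rw [Multiset.cons_bind, Multiset.cons_bind]
    exact (h a (Multiset.mem_cons_self a m)).append
      (ih fun b hb => h b (Multiset.mem_cons_of_mem hb))

theorem extend {r' : Y → FinSum Y' → Prop} {f : X → FinSum Y} {g : X' → FinSum Y'}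
    (hr : ∀ x φ, r x φ → LinRed r' (f x) (φ.bind g)) {ξ : FinSum X} {φ : FinSum X'}
    (h : LinRed r ξ φ) : LinRed r' (ξ.bind f) (φ.bind g) := by
  induction h with
  | zero => exact zero
  | add hx _ ih =>
    rw [Multiset.cons_bind, Multiset.add_bind]
    exact (hr _ _ hx).append ih

theorem extend₂ {r₁ : Y → FinSum Y' → Prop} {r₂ : Z → FinSum Z' → Prop} {f : X → Y → FinSum Z}
    {g : X' → Y' → FinSum Z'}
    (hr : ∀ x φ y ψ, r x φ → r₁ y ψ → LinRed r₂ (f x y) (φ.bind fun a => ψ.bind fun b => g a b))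
    {ξ : FinSum X} {φ : FinSum X'} {υ : FinSum Y} {ψ : FinSum Y'} (h : LinRed r ξ φ)
    (h' : LinRed r₁ υ ψ) :
    LinRed r₂ (ξ.bind fun a => υ.bind fun b => f a b)
      (φ.bind fun a => ψ.bind fun b => g a b) := by
  refine h.extend fun x φ hx => ?_
  rw [Multiset.bind_bind]
  refine h'.extend fun y ψ hy => ?_
  rw [Multiset.bind_bind]
  exact hr _ _ _ _ hx hy

/-- Comparing the relations only on the summands of `ξ` makes it possible to record where these come
from, as `Bd.exists_common_reduct` does. -/
theorem mono {r' : X → FinSum X' → Prop} {ξ : FinSum X} {φ : FinSum X'} (h : LinRed r ξ φ)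
    (hr : ∀ x ∈ ξ, ∀ φ, r x φ → r' x φ) : LinRed r' ξ φ := by
  induction h with
  | zero => exact zero
  | add hx _ ih =>
    exact add (hr _ (Multiset.mem_cons_self _ _) _ hx)
      (ih fun y hy => hr y (Multiset.mem_cons_of_mem hy))

end LinRed

/-! ### Sums of monomials -/

theorem bagSum_zero : bagSum 0 = {0} := rfl

theorem bagSum_cons (σ : FinSum Term) (M : Multiset (FinSum Term)) :
    bagSum (σ ::ₘ M) = consSum σ (bagSum M) := Multiset.sections_cons M σ

theorem card_of_mem_bagSum {M : Multiset (FinSum Term)} {t : Mon} (h : t ∈ bagSum M) :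
    Multiset.card t = Multiset.card M :=
  (Multiset.card_eq_card_of_rel (Multiset.mem_sections.1 h)).symm

theorem bagSum_singleton (σ : FinSum Term) : bagSum {σ} = σ.map fun s => {s} := by
  rw [← Multiset.cons_zero, bagSum_cons, bagSum_zero]
  simp [consSum, Multiset.bind_singleton]

theorem map_bagSum (f : Term → Term) (M : Multiset (FinSum Term)) :
    (bagSum M).map (Multiset.map f) = bagSum (M.map (Multiset.map f)) := by
  induction M using Multiset.induction_on with
  | empty => simp [bagSum_zero]
  | cons σ M ih =>
    simp only [Multiset.map_cons, bagSum_cons, ← ih, consSum, Multiset.map_bind,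
      Multiset.bind_map, Multiset.map_map, Function.comp_def]

/-- A summand of `[σ₁, …, σᵣ]` picks one term in each factor, so splitting it amounts to splitting
the multiset of factors first. -/
theorem bagSum_bind_antidiagonal {β : Type} (M : Multiset (FinSum Term))
    (F : Mon → Mon → Multiset β) :
    ((bagSum M).bind fun u => u.antidiagonal.bind fun p => F p.1 p.2) =
      M.antidiagonal.bind fun q => (bagSum q.1).bind fun u => (bagSum q.2).bind fun v => F u v := by
  induction M using Multiset.induction_on generalizing F with
  | empty => simp [bagSum_zero]
  | cons σ M ih =>
    simp only [bagSum_cons, consSum, Multiset.bind_assoc, Multiset.bind_map,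
      Multiset.antidiagonal_cons, Multiset.add_bind, id, Multiset.bind_add, Prod.map_fst,
      Prod.map_snd]
    congr 1
    · refine (Multiset.bind_congr fun a _ => ih fun x y => F x (a ::ₘ y)).trans ?_
      rw [Multiset.bind_bind]
      refine Multiset.bind_congr fun q _ => ?_
      rw [Multiset.bind_bind]
    · refine (Multiset.bind_congr fun a _ => ih fun x y => F (a ::ₘ x) y).trans ?_
      rw [Multiset.bind_bind]

/-! ### Reduction of monomials -/

theorem monRed_zero (r : Term → FinSum Term → Prop) : MonRed r 0 {0} :=
  ⟨0, by simp, rfl, rfl⟩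

theorem MonRed.cons {r : Term → FinSum Term → Prop} {s : Term} {σ : FinSum Term} {t : Mon}
    {τ : FinSum Mon} (hs : r s σ) (ht : MonRed r t τ) : MonRed r (s ::ₘ t) (consSum σ τ) := by
  obtain ⟨L, hL, rfl, rfl⟩ := ht
  refine ⟨(s, σ) ::ₘ L, ?_, by simp, by rw [Multiset.map_cons, bagSum_cons]⟩
  simpa using ⟨hs, fun a b => hL (a, b)⟩

theorem MonRed.eq_of_zero {r : Term → FinSum Term → Prop} {τ : FinSum Mon} (h : MonRed r 0 τ) :
    τ = {0} := by
  obtain ⟨L, hL, h0, rfl⟩ := h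
  rw [Multiset.map_eq_zero.1 h0.symm]
  rfl

theorem MonRed.exists_of_cons {r : Term → FinSum Term → Prop} {s : Term} {t : Mon}
    {τ : FinSum Mon} (h : MonRed r (s ::ₘ t) τ) :
    ∃ σ τ', r s σ ∧ MonRed r t τ' ∧ τ = consSum σ τ' := by
  classical
  obtain ⟨L, hL, h0, rfl⟩ := h
  obtain ⟨p, hp, rfl, ht⟩ := (Multiset.map_eq_cons _ _ _ _).2 h0.symm
  refine ⟨p.2, bagSum ((L.erase p).map Prod.snd), hL p hp,
    ⟨L.erase p, fun q hq => hL q (Multiset.mem_of_mem_erase hq), ht.symm, rfl⟩, ?_⟩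
  rw [← bagSum_cons, ← Multiset.map_cons, Multiset.cons_erase hp]

theorem MonRed.induction {r : Term → FinSum Term → Prop} {p : Mon → FinSum Mon → Prop}
    (zero : p 0 {0})
    (cons : ∀ s σ t τ, r s σ → MonRed r t τ → p t τ → p (s ::ₘ t) (consSum σ τ))
    {t : Mon} {τ : FinSum Mon} (h : MonRed r t τ) : p t τ := by
  induction t using Multiset.induction_on generalizing τ with
  | empty => rwa [h.eq_of_zero]
  | cons s t ih =>
    obtain ⟨σ, τ', hs, ht, rfl⟩ := h.exists_of_cons
    exact cons s σ t τ' hs ht (ih ht)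

theorem MonRed.mono {r r' : Term → FinSum Term → Prop} (hr : ∀ s σ, r s σ → r' s σ) {t : Mon}
    {τ : FinSum Mon} (h : MonRed r t τ) : MonRed r' t τ := by
  obtain ⟨L, hL, rfl, rfl⟩ := h
  exact ⟨L, fun p hp => hr _ _ (hL p hp), rfl, rfl⟩

theorem MonRed.refl {r : Term → FinSum Term → Prop} {t : Mon} (hr : ∀ s ∈ t, r s {s}) :
    MonRed r t {t} := by
  induction t using Multiset.induction_on with
  | empty => exact monRed_zero r
  | cons s t ih =>
    simpa [consSum] using MonRed.cons (hr s (Multiset.mem_cons_self s t))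
      (ih fun u hu => hr u (Multiset.mem_cons_of_mem hu))

/-! ### Boundedly nested parallel reduction -/

theorem BdTerm.app_of_monRed {b : ℕ} {s : Term} {σ : FinSum Term} {t : Mon} {τ : FinSum Mon}
    (hs : BdTerm b s σ) (ht : MonRed (BdTerm b) t τ) : BdTerm b (.app s t) (appSum σ τ) := by
  obtain ⟨L, hL, rfl, rfl⟩ := ht
  exact .app L hs hL

theorem BdTerm.redex_of_monRed {b : ℕ} {s : Term} {σ : FinSum Term} {t : Mon} {τ : FinSum Mon}
    (hs : BdTerm b s σ) (ht : MonRed (BdTerm b) t τ) :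
    BdTerm (b + 1) (.app (.lam s) t) (lsubstSum σ τ) := by
  obtain ⟨L, hL, rfl, rfl⟩ := ht
  exact .redex L hs hL

/-- The argument of an application is kept as one `MonRed`, whose relation bundles the reduction
with the induction hypothesis, so that lemmas on monomials apply directly. -/
theorem BdTerm.rec_monRed {p : ℕ → Term → FinSum Term → Prop}
    (var : ∀ b n, p b (.var n) {.var n})
    (lam : ∀ b s σ, BdTerm b s σ → p b s σ → p b (.lam s) (lamSum σ))
    (app : ∀ b s σ t τ, p b s σ → MonRed (fun s σ => BdTerm b s σ ∧ p b s σ) t τ →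
      p b (.app s t) (appSum σ τ))
    (redex : ∀ b s σ t τ, p b s σ → MonRed (fun s σ => BdTerm b s σ ∧ p b s σ) t τ →
      p (b + 1) (.app (.lam s) t) (lsubstSum σ τ))
    {b : ℕ} {s : Term} {σ : FinSum Term} (h : BdTerm b s σ) : p b s σ := by
  induction h with
  | var b n => exact var b n
  | lam hs ih => exact lam _ _ _ hs ih
  | app L _ hL ih ihL =>
    exact app _ _ _ _ _ ih ⟨L, fun q hq => ⟨hL q hq, ihL q hq⟩, rfl, rfl⟩
  | redex L _ hL ih ihL =>
    exact redex _ _ _ _ _ ih ⟨L, fun q hq => ⟨hL q hq, ihL q hq⟩, rfl, rfl⟩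

theorem BdTerm.mono {b c : ℕ} (hbc : b ≤ c) {s : Term} {σ : FinSum Term} (h : BdTerm b s σ) :
    BdTerm c s σ := by
  induction h generalizing c with
  | var b n => exact .var c n
  | lam _ ih => exact .lam (ih hbc)
  | app L _ _ ih ihL => exact .app L (ih hbc) fun p hp => ihL p hp hbc
  | redex L _ _ ih ihL =>
    obtain ⟨c, rfl⟩ : ∃ d, c = d + 1 := ⟨c - 1, by omega⟩
    exact .redex L (ih (by omega)) fun p hp => ihL p hp (by omega)

/-- No redex is fired, so any bound will do. Hence the reflexive closure adds nothing to bounded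
reduction itself. -/
theorem BdTerm.refl (b : ℕ) (s : Term) : BdTerm b s {s} := by
  induction s using Term.induction with
  | var n => exact .var b n
  | lam s ih => simpa [lamSum] using BdTerm.lam ih
  | app s t ihs iht => simpa [appSum] using ihs.app_of_monRed (MonRed.refl iht)

theorem BdTerm.parTerm {b : ℕ} {s : Term} {σ : FinSum Term} (h : BdTerm b s σ) : ParTerm s σ := by
  induction h with
  | var b n => exact .var n
  | lam _ ih => exact .lam ih
  | app L _ _ ih ihL => exact .app L ih ihL
  | redex L _ _ ih ihL => exact .redex L ih ihL

theorem map_rename_lsubstSum (f : ℕ → ℕ) (σ : FinSum Term) (τ : FinSum Mon) :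
    (lsubstSum σ τ).map (Term.rename f) =
      lsubstSum (σ.map (Term.rename (Term.liftRen f))) (τ.map (Multiset.map (Term.rename f))) := by
  have hf : Extends f (Term.liftRen f) 0 0 := by
    refine ⟨rfl, fun n hn => ?_, fun n hn => ?_⟩ <;>
    · obtain ⟨n, rfl⟩ := Nat.exists_eq_succ_of_ne_zero hn
      simp [Term.liftRen, lowerVar]
  simp only [lsubstSum, Multiset.map_bind, Multiset.bind_map, map_rename_lsubst hf]

theorem MonRed.map {r r' : Term → FinSum Term → Prop} {f : Term → Term}
    (hr : ∀ s σ, r s σ → r' (f s) (σ.map f)) {t : Mon} {τ : FinSum Mon} (h : MonRed r t τ) :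
    MonRed r' (t.map f) (τ.map (Multiset.map f)) := by
  obtain ⟨L, hL, rfl, rfl⟩ := h
  refine ⟨L.map fun p => (f p.1, p.2.map f), ?_, ?_, ?_⟩
  · simp only [Multiset.mem_map]
    rintro _ ⟨p, hp, rfl⟩
    exact hr _ _ (hL p hp)
  · simp
  · simp [map_bagSum]

theorem BdTerm.rename {b : ℕ} {s : Term} {σ : FinSum Term} (h : BdTerm b s σ) (f : ℕ → ℕ) :
    BdTerm b (s.rename f) (σ.map (Term.rename f)) := by
  refine BdTerm.rec_monRed
    (p := fun b s σ => ∀ f, BdTerm b (s.rename f) (σ.map (Term.rename f)))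
    (fun b n f => ?_) (fun b s σ _ ih f => ?_) (fun b s σ t τ ih ht f => ?_)
    (fun b s σ t τ ih ht f => ?_) h f
  · simpa using BdTerm.var b (f n)
  · simpa [lamSum, Function.comp_def] using BdTerm.lam (ih (Term.liftRen f))
  · have := (ih f).app_of_monRed (ht.map fun s σ h => h.2 f)
    simpa [appSum, Multiset.map_bind, Multiset.bind_map, Function.comp_def] using this
  · have := (ih (Term.liftRen f)).redex_of_monRed (ht.map fun s σ h => h.2 f)
    rwa [map_rename_lsubstSum, Term.rename_app, Term.rename_lam]

/-! ### Reduction of a substituted expression -/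

/-- The reduct `ξ` of `x` is compatible with the substitution of reducts for the relation `BdTerm n`,
the resulting reductions being instances of `R`. -/
def SubstRed {X : Type} (n : ℕ) (S : X → ℕ → Mon → FinSum X) (R : X → FinSum X → Prop) (x : X)
    (ξ : FinSum X) : Prop :=
  ∀ (k : ℕ) (u : Mon) (υ : FinSum Mon), MonRed (BdTerm n) u υ →
    LinRed R (S x k u) (ξ.bind fun x' => υ.bind fun u' => S x' k u')

/-- The splittings of a monomial reduce to the splittings of its reducts. -/
theorem MonRed.linRed_antidiagonal {r : Term → FinSum Term → Prop} {X Y : Type}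
    {R : X → FinSum Y → Prop} {u : Mon} {υ : FinSum Mon} (hu : MonRed r u υ)
    {F : Mon → Mon → FinSum X} {G : Mon → Mon → FinSum Y}
    (h : ∀ u₁ υ₁ u₂ υ₂, MonRed r u₁ υ₁ → MonRed r u₂ υ₂ →
      LinRed R (F u₁ u₂) (υ₁.bind fun v₁ => υ₂.bind fun v₂ => G v₁ v₂)) :
    LinRed R (u.antidiagonal.bind fun p => F p.1 p.2)
      (υ.bind fun v => v.antidiagonal.bind fun p => G p.1 p.2) := by
  obtain ⟨L, hL, rfl, rfl⟩ := hu
  rw [bagSum_bind_antidiagonal, antidiagonal_map, antidiagonal_map, Multiset.bind_map,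
    Multiset.bind_map]
  refine LinRed.bind fun p hp => ?_
  have hp' := Multiset.mem_antidiagonal.1 hp
  refine h _ _ _ _ ⟨p.1, fun q hq => hL q ?_, rfl, rfl⟩ ⟨p.2, fun q hq => hL q ?_, rfl, rfl⟩ <;>
  · rw [← hp']
    simp [hq]

theorem SubstRed.op {X Y Z : Type} {n : ℕ} {op : X → Y → Z} {SX : X → ℕ → Mon → FinSum X}
    {SY : Y → ℕ → Mon → FinSum Y} {SZ : Z → ℕ → Mon → FinSum Z} (hop : SubstOp op SX SY SZ)
    {RX : X → FinSum X → Prop} {RY : Y → FinSum Y → Prop} {RZ : Z → FinSum Z → Prop}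
    (hR : ∀ x ξ y υ, RX x ξ → RY y υ → RZ (op x y) (ξ.bind fun a => υ.map fun b => op a b))
    {x : X} {ξ : FinSum X} {y : Y} {υ : FinSum Y} (hx : SubstRed n SX RX x ξ)
    (hy : SubstRed n SY RY y υ) :
    SubstRed n SZ RZ (op x y) (ξ.bind fun a => υ.map fun b => op a b) := by
  intro k u ω hu
  replace hop : ∀ x y k u, SZ (op x y) k u = u.antidiagonal.bind fun p =>
    (SX x k p.1).bind fun a => (SY y k p.2).map fun b => op a b := hop
  have e : ((ξ.bind fun a => υ.map fun b => op a b).bind fun z => ω.bind fun u' => SZ z k u') =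
      ω.bind fun u' => u'.antidiagonal.bind fun p => (ξ.bind fun a => SX a k p.1).bind fun a' =>
        (υ.bind fun b => SY b k p.2).map fun b' => op a' b' := by
    simp only [Multiset.bind_assoc, Multiset.bind_map, Multiset.map_bind]
    rw [bind_bind_comm]
    refine Multiset.bind_congr fun u' _ => ?_
    simp only [hop]
    rw [bind_bind_comm]
    refine Multiset.bind_congr fun p _ => Multiset.bind_congr fun a _ => ?_
    rw [Multiset.bind_bind]
  rw [e, hop]
  refine hu.linRed_antidiagonal (F := fun u₁ u₂ => (SX x k u₁).bind fun a => (SY y k u₂).map fun b =>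
    op a b) (G := fun u₁ u₂ => (ξ.bind fun a => SX a k u₁).bind fun a' =>
        (υ.bind fun b => SY b k u₂).map fun b' => op a' b') fun u₁ υ₁ u₂ υ₂ h₁ h₂ => ?_
  have key := LinRed.extend₂ (r₂ := RZ) (f := fun a b => {op a b}) (g := fun a b => {op a b})
    (fun x φ y ψ hx hy => LinRed.single (by simpa [Multiset.bind_singleton] using hR x φ y ψ hx hy))
    (hx k u₁ υ₁ h₁) (hy k u₂ υ₂ h₂)
  rw [Multiset.bind_bind ξ, Multiset.bind_bind υ, bind_bind_bind] at key
  simpa only [Multiset.bind_singleton] using key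

/-- By `substComm_lsubst` at index `0`, substituting in the contracted redex is the same as
contracting after substituting in its body and its argument. This single contraction accounts for
the `+ 1`. -/
theorem SubstRed.redex {m n : ℕ} {s : Term} {σ : FinSum Term} {t : Mon} {τ : FinSum Mon}
    (hs : SubstRed n lsubst (BdTerm m) s σ) (ht : SubstRed n lsubstMon (MonRed (BdTerm m)) t τ) :
    SubstRed n lsubst (BdTerm (m + 1)) (.app (.lam s) t) (lsubstSum σ τ) := by
  intro k u υ hu
  have e : ((lsubstSum σ τ).bind fun r => υ.bind fun u' => lsubst r k u') =
      υ.bind fun u' => u'.antidiagonal.bind fun p =>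
        (σ.bind fun a => lsubst a (k + 1) (p.1.map Term.shift)).bind fun a' =>
        (τ.bind fun b => lsubstMon b k p.2).bind fun b' => lsubst a' 0 b' := by
    simp only [lsubstSum, Multiset.bind_assoc]
    refine (Multiset.bind_congr fun a _ => (Multiset.bind_congr fun b _ =>
      Multiset.bind_bind _ _)).trans ?_
    rw [bind_bind_comm]
    refine Multiset.bind_congr fun u' _ => ?_
    refine (Multiset.bind_congr fun a _ => (Multiset.bind_congr fun b _ =>
      substComm_lsubst a 0 k b u' (Nat.zero_le k))).trans ?_
    rw [bind_bind_comm]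
    refine Multiset.bind_congr fun p _ => Multiset.bind_congr fun a _ => ?_
    rw [Multiset.bind_bind τ]
    rfl
  rw [e, lsubst_app]
  refine hu.linRed_antidiagonal (F := fun u₁ u₂ => appSum (lsubst (.lam s) k u₁) (lsubstMon t k u₂))
    (G := fun u₁ u₂ => (σ.bind fun a => lsubst a (k + 1) (u₁.map Term.shift)).bind fun a' =>
        (τ.bind fun b => lsubstMon b k u₂).bind fun b' => lsubst a' 0 b')
    fun u₁ υ₁ u₂ υ₂ h₁ h₂ => ?_
  have key := LinRed.extend₂ (r₂ := BdTerm (m + 1)) (f := fun a b => {.app (.lam a) b})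
    (g := fun a b => lsubst a 0 b)
    (fun x φ y ψ hx hy => LinRed.single (hx.redex_of_monRed hy))
    (hs (k + 1) (u₁.map Term.shift) (υ₁.map (Multiset.map Term.shift))
      (h₁.map fun s σ h => h.rename Nat.succ)) (ht k u₂ υ₂ h₂)
  rw [Multiset.bind_bind σ, Multiset.bind_bind τ, bind_bind_bind] at key
  simpa only [Multiset.bind_singleton, appSum, lsubst_lam, lamSum, Multiset.bind_map]
    using key

theorem substRed_var (b n i : ℕ) : SubstRed n lsubst (BdTerm (b + n)) (.var i) {.var i} := by
  rintro k u υ ⟨L, hL, rfl, rfl⟩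
  rw [Multiset.singleton_bind]
  -- All summands of the reduct have the cardinality of the source monomial, so the cardinality
  -- tests in substitution have the same outcome on both sides.
  have hc : ∀ v ∈ bagSum (L.map Prod.snd), Multiset.card v = Multiset.card L := fun v hv => by
    rw [card_of_mem_bagSum hv, Multiset.card_map]
  rcases eq_or_ne i k with rfl | hik
  · simp only [lsubst_var_self, Multiset.card_map]
    rw [Multiset.bind_congr fun v hv => by rw [hc v hv], bind_ite_zero]
    split_ifs with h
    · obtain ⟨p, rfl⟩ := Multiset.card_eq_one.1 h
      rw [Multiset.map_singleton, Multiset.map_singleton, bagSum_singleton, Multiset.bind_map,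
        show (p.2.bind fun a => {a}) = p.2 from (Multiset.bind_singleton p.2 id).trans
          (Multiset.map_id _)]
      exact LinRed.single ((hL p (Multiset.mem_singleton_self p)).mono (by omega))
    · exact LinRed.zero
  · simp only [lsubst_var_of_ne hik, Multiset.card_map]
    rw [Multiset.bind_congr fun v hv => by rw [hc v hv], bind_ite_zero]
    split_ifs with h
    · rw [Multiset.card_eq_zero.1 h, Multiset.map_zero, bagSum_zero, Multiset.singleton_bind]
      exact LinRed.single (BdTerm.var _ _)
    · exact LinRed.zero

theorem substRed_lsubstMon {n m : ℕ} {r : Term → FinSum Term → Prop} {t : Mon} {τ : FinSum Mon}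
    (ht : MonRed (fun s σ => r s σ ∧ SubstRed n lsubst (BdTerm m) s σ) t τ) :
    SubstRed n lsubstMon (MonRed (BdTerm m)) t τ := by
  refine MonRed.induction (p := fun t τ => SubstRed n lsubstMon (MonRed (BdTerm m)) t τ) ?_
    (fun s σ t τ hs _ ih => hs.2.op substOp_cons (fun x ξ y υ hx hy => MonRed.cons hx hy) ih) ht
  · rintro k u υ ⟨L, hL, rfl, rfl⟩
    have hc : ∀ v ∈ bagSum (L.map Prod.snd), Multiset.card v = Multiset.card L := fun v hv => by
      rw [card_of_mem_bagSum hv, Multiset.card_map]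
    simp only [Multiset.singleton_bind, lsubstMon_zero, Multiset.card_map]
    rw [Multiset.bind_congr fun v hv => by rw [hc v hv], bind_ite_zero]
    split_ifs with h
    · rw [Multiset.card_eq_zero.1 h, Multiset.map_zero, bagSum_zero, Multiset.singleton_bind]
      exact LinRed.single (monRed_zero _)
    · exact LinRed.zero

/-- The redexes fired in the substituted terms land at variable occurrences, at worst below `m`
nested fired redexes of `s`; hence the bound `m + n`. -/
theorem BdTerm.substRed {m n : ℕ} {s : Term} {σ : FinSum Term} (h : BdTerm m s σ) :
    SubstRed n lsubst (BdTerm (m + n)) s σ := by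
  refine BdTerm.rec_monRed (p := fun m s σ => SubstRed n lsubst (BdTerm (m + n)) s σ)
    (fun b i => substRed_var b n i) (fun b s σ _ ih => ?_) (fun b s σ t τ ih ht => ?_)
    (fun b s σ t τ ih ht => ?_) h
  · intro k u υ hu
    have := (ih (k + 1) (u.map Term.shift) (υ.map (Multiset.map Term.shift)) (hu.map fun s σ h => h.rename Nat.succ)).extend
      (r' := BdTerm (b + n)) (f := fun a => {Term.lam a}) (g := fun a => {Term.lam a})
      fun x φ hx => LinRed.single (by simpa [lamSum, Multiset.bind_singleton] using BdTerm.lam hx)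
    simpa only [lsubst_lam, lamSum, Multiset.bind_map, Multiset.bind_singleton, Multiset.map_bind]
      using this
  · exact ih.op substOp_app (fun x ξ y υ hx hy => hx.app_of_monRed hy) (substRed_lsubstMon ht)
  · rw [show b + 1 + n = b + n + 1 by omega]
    exact ih.redex (substRed_lsubstMon ht)

/-! ### Inversion of reductions -/

theorem BdTerm.of_var {b n : ℕ} {σ : FinSum Term} (h : BdTerm b (.var n) σ) : σ = {.var n} := by
  generalize hs : Term.var n = s at h
  cases h with
  | var b m => rfl
  | lam _ => exact (Term.var_ne_lam hs).elim
  | app L _ _ => exact (Term.var_ne_app hs).elim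
  | redex L _ _ => exact (Term.var_ne_app hs).elim

theorem BdTerm.of_lam {b : ℕ} {s : Term} {σ : FinSum Term} (h : BdTerm b (.lam s) σ) :
    ∃ σ', BdTerm b s σ' ∧ σ = lamSum σ' := by
  generalize hs : Term.lam s = r at h
  cases h with
  | var b m => exact (Term.var_ne_lam hs.symm).elim
  | lam h => exact ⟨_, Term.lam_injective hs ▸ h, rfl⟩
  | app L _ _ => exact (Term.lam_ne_app hs).elim
  | redex L _ _ => exact (Term.lam_ne_app hs).elim

theorem BdTerm.of_app {b : ℕ} {s : Term} {t : Mon} {σ : FinSum Term} (h : BdTerm b (.app s t) σ) :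
    (∃ σ' τ, BdTerm b s σ' ∧ MonRed (BdTerm b) t τ ∧ σ = appSum σ' τ) ∨
      ∃ c s' σ' τ, b = c + 1 ∧ s = .lam s' ∧ BdTerm c s' σ' ∧ MonRed (BdTerm c) t τ ∧
        σ = lsubstSum σ' τ := by
  generalize hs : Term.app s t = r at h
  cases h with
  | var b m => exact (Term.var_ne_app hs.symm).elim
  | lam h => exact (Term.lam_ne_app hs.symm).elim
  | app L h hL =>
    obtain ⟨rfl, rfl⟩ := Term.app_injective hs
    exact .inl ⟨_, _, h, ⟨L, hL, rfl, rfl⟩, rfl⟩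
  | redex L h hL =>
    obtain ⟨rfl, rfl⟩ := Term.app_injective hs
    exact .inr ⟨_, _, _, _, rfl, rfl, h, ⟨L, hL, rfl, rfl⟩, rfl⟩

/-! ### Contextual closure of the linear extension -/

theorem lamSum_eq_bind (σ : FinSum Term) : lamSum σ = σ.bind fun s => {.lam s} :=
  (Multiset.bind_singleton σ _).symm

theorem appSum_eq_bind (σ : FinSum Term) (τ : FinSum Mon) :
    appSum σ τ = σ.bind fun s => τ.bind fun t => {.app s t} := by
  simp only [Multiset.bind_singleton, appSum]

theorem consSum_eq_bind (σ : FinSum Term) (τ : FinSum Mon) :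
    consSum σ τ = σ.bind fun s => τ.bind fun t => {s ::ₘ t} := by
  simp only [Multiset.bind_singleton, consSum]

theorem LinRed.lamSum {b : ℕ} {σ σ' : FinSum Term} (h : LinRed (BdTerm b) σ σ') :
    LinRed (BdTerm b) (lamSum σ) (lamSum σ') := by
  rw [lamSum_eq_bind, lamSum_eq_bind]
  exact h.extend fun s φ hs => .single (by simpa only [lamSum_eq_bind] using BdTerm.lam hs)

theorem LinRed.appSum {b : ℕ} {σ σ' : FinSum Term} {τ τ' : FinSum Mon}
    (h : LinRed (BdTerm b) σ σ') (h' : LinRed (MonRed (BdTerm b)) τ τ') :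
    LinRed (BdTerm b) (appSum σ τ) (appSum σ' τ') := by
  rw [appSum_eq_bind, appSum_eq_bind]
  exact h.extend₂ (fun s φ t ψ hs ht => .single
    (by simpa only [appSum_eq_bind] using hs.app_of_monRed ht)) h'

theorem LinRed.consSum {r : Term → FinSum Term → Prop} {σ σ' : FinSum Term} {τ τ' : FinSum Mon}
    (h : LinRed r σ σ') (h' : LinRed (MonRed r) τ τ') :
    LinRed (MonRed r) (consSum σ τ) (consSum σ' τ') := by
  rw [consSum_eq_bind, consSum_eq_bind]
  exact h.extend₂ (fun s φ t ψ hs ht => .single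
    (by simpa only [consSum_eq_bind] using MonRed.cons hs ht)) h'

/-- This serves the reducts in which a redex was left in place while another reduct contracts it. -/
theorem LinRed.redex {b : ℕ} {σ σ' : FinSum Term} {τ τ' : FinSum Mon}
    (h : LinRed (BdTerm b) σ σ') (h' : LinRed (MonRed (BdTerm b)) τ τ') :
    LinRed (BdTerm (b + 1)) (Resource.appSum (Resource.lamSum σ) τ) (lsubstSum σ' τ') := by
  rw [appSum_eq_bind, Resource.lamSum, Multiset.bind_map]
  exact h.extend₂ (fun s φ t ψ hs ht => .single (hs.redex_of_monRed ht)) h'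

/-- This serves the reducts in which the redex is already contracted; `b + b` is the source of the
exponential bound. -/
theorem LinRed.lsubstSum {b : ℕ} {σ σ' : FinSum Term} {τ τ' : FinSum Mon}
    (h : LinRed (BdTerm b) σ σ') (h' : LinRed (MonRed (BdTerm b)) τ τ') :
    LinRed (BdTerm (b + b)) (lsubstSum σ τ) (lsubstSum σ' τ') :=
  h.extend₂ (r₂ := BdTerm (b + b)) (fun _ _ _ _ hs ht => hs.substRed 0 _ _ ht) h'

/-! ### Common reducts of finite families of reducts -/

section CommonReduct

variable {K : Type} [Fintype K]

/-- Finite families of reducts of `x`, with nesting bounded by `b k` for the `k`-th reduct, have a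
common reduct. -/
def CommonReduct (K : Type) [Fintype K] {X : Type} (R : ℕ → X → FinSum X → Prop) (x : X) : Prop :=
  ∀ (b : K → ℕ) (ξ : K → FinSum X), (∀ k, R (b k) x (ξ k)) →
    ∃ φ, ∀ k, LinRed (R (2 ^ ∑ k, b k)) (ξ k) φ

theorem commonReduct_mon {t : Mon} (h : ∀ s ∈ t, CommonReduct K BdTerm s) :
    CommonReduct K (fun b => MonRed (BdTerm b)) t := by
  induction t using Multiset.induction_on with
  | empty =>
    refine fun b ξ hξ => ⟨{0}, fun k => ?_⟩
    rw [(hξ k).eq_of_zero]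
    exact .single (monRed_zero _)
  | cons s t ih =>
    intro b ξ hξ
    choose σ τ hσ hτ hξ using fun k => (hξ k).exists_of_cons
    obtain ⟨φ, hφ⟩ := h s (Multiset.mem_cons_self s t) b σ hσ
    obtain ⟨ψ, hψ⟩ := ih (fun r hr => h r (Multiset.mem_cons_of_mem hr)) b τ hτ
    exact ⟨consSum φ ψ, fun k => hξ k ▸ (hφ k).consSum (hψ k)⟩

theorem commonReduct_lam {s : Term} (h : CommonReduct K BdTerm s) :
    CommonReduct K BdTerm (.lam s) := by
  intro b ξ hξ
  choose σ hσ hξ using fun k => (hξ k).of_lam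
  obtain ⟨φ, hφ⟩ := h b σ hσ
  exact ⟨lamSum φ, fun k => hξ k ▸ (hφ k).lamSum⟩

/-- If no reduct needs the root redex, the components are joined separately. Otherwise some `ξ i`
contracts it, and all the reducts are joined at the contracted form: those that have not contracted
the redex do so now. -/
theorem commonReduct_app {s : Term} {t : Mon} (hs : CommonReduct K BdTerm s)
    (hlam : ∀ s', s = .lam s' → CommonReduct K BdTerm s')
    (ht : CommonReduct K (fun b => MonRed (BdTerm b)) t) : CommonReduct K BdTerm (.app s t) := by
  intro b ξ hξ
  by_cases H : ∀ k, ∃ σ' τ, BdTerm (b k) s σ' ∧ MonRed (BdTerm (b k)) t τ ∧ ξ k = appSum σ' τ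
  · choose σ τ hσ hτ hξ using H
    obtain ⟨φ, hφ⟩ := hs b σ hσ
    obtain ⟨ψ, hψ⟩ := ht b τ hτ
    exact ⟨appSum φ ψ, fun k => hξ k ▸ (hφ k).appSum (hψ k)⟩
  obtain ⟨i, hi⟩ := not_forall.1 H
  obtain ⟨c, s', σi, τi, hc, rfl, hσi, hτi, hξi⟩ := (hξ i).of_app.resolve_left hi
  -- `a k` is the bound left for the body and the argument: one less than `b k` if the `k`-th reduct
  -- contracts the root redex, `b k` otherwise. At `i` it is strictly smaller.
  have step : ∀ k, ∃ (a : ℕ) (σ : FinSum Term) (τ : FinSum Mon), a ≤ b k ∧ (k = i → a < b k) ∧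
      BdTerm a s' σ ∧ MonRed (BdTerm a) t τ ∧
      (ξ k = lsubstSum σ τ ∨ ξ k = appSum (lamSum σ) τ) := by
    intro k
    by_cases hk : k = i
    · subst hk
      exact ⟨c, σi, τi, by omega, by omega, hσi, hτi, .inl hξi⟩
    rcases (hξ k).of_app with ⟨σ, τ, hσ, hτ, e⟩ | ⟨c, s'', σ, τ, hc, hs'', hσ, hτ, e⟩
    · obtain ⟨σ, hσ', rfl⟩ := hσ.of_lam
      exact ⟨b k, σ, τ, le_rfl, fun h => (hk h).elim, hσ', hτ, .inr e⟩
    · obtain rfl := Term.lam_injective hs''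
      exact ⟨c, σ, τ, by omega, by omega, hσ, hτ, .inl e⟩
  choose a σ τ hab hai hσ hτ hcase using step
  have hlt : ∑ k, a k + 1 ≤ ∑ k, b k :=
    Finset.sum_lt_sum (fun k _ => hab k) ⟨i, Finset.mem_univ i, hai i rfl⟩
  -- The strict drop at `i` pays for the doubling caused by substitution.
  have hpow : 2 ^ (∑ k, a k) + 2 ^ (∑ k, a k) ≤ 2 ^ ∑ k, b k := by
    rw [← two_mul, ← pow_succ']
    exact Nat.pow_le_pow_right (by omega) hlt
  obtain ⟨φ, hφ⟩ := hlam s' rfl a σ hσ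
  obtain ⟨ψ, hψ⟩ := ht a τ hτ
  refine ⟨lsubstSum φ ψ, fun k => ?_⟩
  rcases hcase k with e | e
  · rw [e]
    exact ((hφ k).lsubstSum (hψ k)).mono fun _ _ _ h => h.mono hpow
  · rw [e]
    exact ((hφ k).redex (hψ k)).mono fun _ _ _ h => h.mono
      (le_trans (Nat.add_le_add_left Nat.one_le_two_pow _) hpow)

theorem commonReduct_term (s : Term) : CommonReduct K BdTerm s := by
  -- The root redex case needs the induction hypothesis for the body of the abstraction in function
  -- position, two constructors down.
  suffices CommonReduct K BdTerm s ∧ ∀ s', s = .lam s' → CommonReduct K BdTerm s' from this.1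
  induction s using Term.induction with
  | var n =>
    refine ⟨fun b ξ hξ => ⟨{.var n}, fun k => ?_⟩, fun s' h => (Term.var_ne_lam h).elim⟩
    rw [(hξ k).of_var]
    exact .single (.var _ n)
  | lam s ih =>
    exact ⟨commonReduct_lam ih.1, fun s' h => Term.lam_injective h ▸ ih.1⟩
  | app s t ihs iht =>
    exact ⟨commonReduct_app ihs.1 ihs.2 (commonReduct_mon fun r hr => (iht r hr).1),
      fun s' h => (Term.lam_ne_app h.symm).elim⟩

theorem commonReduct_expr (κ : Kind) (e : Expr κ) : CommonReduct K (fun b => Bd b κ) e := by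
  cases κ with
  | term => exact commonReduct_term e
  | mon => exact commonReduct_mon fun s _ => commonReduct_term s

end CommonReduct

/-! ### Bounded reduction of expressions of either kind. -/

theorem Bd.refl (b : ℕ) (κ : Kind) (e : Expr κ) : Bd b κ e {e} := by
  cases κ with
  | term => exact BdTerm.refl b e
  | mon => exact MonRed.refl fun s _ => BdTerm.refl b s

theorem Bd.mono {b c : ℕ} (h : b ≤ c) {κ : Kind} {e : Expr κ} {ε : FinSum (Expr κ)}
    (he : Bd b κ e ε) : Bd c κ e ε := by
  cases κ with
  | term => exact BdTerm.mono h he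
  | mon => exact MonRed.mono (fun _ _ hs => hs.mono h) he

theorem Bd.par {b : ℕ} {κ : Kind} {e : Expr κ} {ε : FinSum (Expr κ)} (he : Bd b κ e ε) :
    Par κ e ε := by
  cases κ with
  | term => exact BdTerm.parTerm he
  | mon => exact MonRed.mono (fun _ _ hs => hs.parTerm) he

/-! ### Sizes -/

/-- The number of constructors of a term, monomials not counted. -/
noncomputable def Term.size : Term → ℕ := Term.iter fun
  | .var _ => 1
  | .lam n => n + 1
  | .app n m => n + m.sum + 1

/-- The sum of the sizes of the elements of a monomial. -/
noncomputable def monSize (t : Mon) : ℕ := (t.map Term.size).sum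

namespace Term

@[simp] theorem size_var (n : ℕ) : size (var n) = 1 := iter_var _ _

@[simp] theorem size_lam (s : Term) : size (lam s) = size s + 1 := iter_lam _ _

@[simp] theorem size_app (s : Term) (t : Mon) : size (app s t) = size s + monSize t + 1 :=
  iter_app _ _ _

theorem fv_var (n : ℕ) : fv (var n) = {n} := iter_var _ _

theorem fv_lam (s : Term) : fv (lam s) = {n | n + 1 ∈ fv s} := iter_lam _ _

theorem fv_app (s : Term) (t : Mon) : fv (app s t) = {n | n ∈ fv s ∨ ∃ u ∈ t, n ∈ fv u} := by
  rw [fv, iter_app]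
  simp only [Multiset.mem_map, exists_exists_and_eq_and]

theorem size_pos (s : Term) : 0 < size s := by
  rcases s.exists_constructor with ⟨n, rfl⟩ | ⟨t, rfl⟩ | ⟨t, u, rfl⟩ <;> simp

theorem size_rename (f : ℕ → ℕ) (s : Term) : size (rename f s) = size s := by
  induction s using Term.induction generalizing f with
  | var n => simp
  | lam s ih => simp [ih]
  | app s t ihs iht =>
    simp only [rename_app, size_app, ihs, monSize, Multiset.map_map, Function.comp_apply]
    rw [Multiset.map_congr rfl fun u hu => iht u hu f]

end Term

@[simp] theorem monSize_zero : monSize 0 = 0 := rfl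

@[simp] theorem monSize_cons (s : Term) (t : Mon) : monSize (s ::ₘ t) = s.size + monSize t := by
  simp [monSize]

@[simp] theorem monSize_add (s t : Mon) : monSize (s + t) = monSize s + monSize t := by
  simp [monSize]

theorem monSize_map_shift (u : Mon) : monSize (u.map Term.shift) = monSize u := by
  simp only [monSize, Multiset.map_map, Function.comp_def, Term.shift, Term.size_rename]

theorem card_le_monSize (t : Mon) : Multiset.card t ≤ monSize t := by
  induction t using Multiset.induction_on with
  | empty => simp
  | cons s t ih =>
    have := s.size_pos
    simp only [Multiset.card_cons, monSize_cons]
    omega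

/-- Each substituted element replaces an occurrence of a variable, of size one. -/
theorem size_of_mem_lsubstMon {t : Mon} {k : ℕ}
    (h : ∀ s ∈ t, ∀ (u : Mon), ∀ r ∈ lsubst s k u, r.size + Multiset.card u = s.size + monSize u)
    {u t' : Mon} (ht : t' ∈ lsubstMon t k u) :
    monSize t' + Multiset.card u = monSize t + monSize u := by
  induction t using Multiset.induction_on generalizing u t' with
  | empty =>
    rw [lsubstMon_zero] at ht
    split_ifs at ht with hu
    · rw [Multiset.mem_singleton.1 ht, Multiset.card_eq_zero.1 hu]; simp
    · simp at ht
  | cons s t ih =>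
    simp only [lsubstMon_cons, consSum, Multiset.mem_bind, Multiset.mem_map] at ht
    obtain ⟨p, hp, a, ha, b, hb, rfl⟩ := ht
    rw [← Multiset.mem_antidiagonal.1 hp]
    have h1 := h s (Multiset.mem_cons_self s t) _ _ ha
    have h2 := ih (fun r hr => h r (Multiset.mem_cons_of_mem hr)) hb
    simp only [monSize_cons, monSize_add, Multiset.card_add]
    omega

theorem size_of_mem_lsubst {s : Term} {k : ℕ} {u : Mon} {r : Term} (hr : r ∈ lsubst s k u) :
    r.size + Multiset.card u = s.size + monSize u := by
  induction s using Term.induction generalizing k u r with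
  | var n =>
    rw [lsubst_var] at hr
    change _ ∈ (if n = k then if Multiset.card u = 1 then u else 0
      else if Multiset.card u = 0 then {Term.var (lowerVar k n)} else 0 : FinSum Term) at hr
    split_ifs at hr with h1 h2 h2
    · obtain ⟨v, rfl⟩ := Multiset.card_eq_one.1 h2
      rw [Multiset.mem_singleton.1 hr]
      simp [monSize, add_comm]
    · simp at hr
    · rw [Multiset.mem_singleton.1 hr, Multiset.card_eq_zero.1 h2]; simp
    · simp at hr
  | lam s ih =>
    simp only [lsubst_lam, lamSum, Multiset.mem_map] at hr
    obtain ⟨v, hv, rfl⟩ := hr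
    have := ih hv
    rw [monSize_map_shift, Multiset.card_map] at this
    simp only [Term.size_lam]
    omega
  | app s t ihs iht =>
    simp only [lsubst_app, appSum, Multiset.mem_bind, Multiset.mem_map] at hr
    obtain ⟨p, hp, a, ha, b, hb, rfl⟩ := hr
    rw [← Multiset.mem_antidiagonal.1 hp]
    have h1 := ihs ha
    have h2 := size_of_mem_lsubstMon (fun s hs u r hr => iht s hs hr) hb
    simp only [Term.size_app, monSize_add, Multiset.card_add]
    omega

theorem monSize_le_of_mem_lsubstMon {t : Mon} {k : ℕ}
    (h : ∀ s ∈ t, ∀ u : Mon, ∀ r ∈ lsubst s k u, monSize u ≤ r.size)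
    {u t' : Mon} (ht : t' ∈ lsubstMon t k u) : monSize u ≤ monSize t' := by
  induction t using Multiset.induction_on generalizing u t' with
  | empty =>
    rw [lsubstMon_zero] at ht
    split_ifs at ht with hu
    · rw [Multiset.card_eq_zero.1 hu]; simp
    · simp at ht
  | cons s t ih =>
    simp only [lsubstMon_cons, consSum, Multiset.mem_bind, Multiset.mem_map] at ht
    obtain ⟨p, hp, a, ha, b, hb, rfl⟩ := ht
    rw [← Multiset.mem_antidiagonal.1 hp, monSize_add, monSize_cons]
    exact Nat.add_le_add (h s (Multiset.mem_cons_self s t) _ _ ha)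
      (ih (fun r hr => h r (Multiset.mem_cons_of_mem hr)) hb)

/-- Substitution is linear: every element of `u` is placed in the result, at disjoint positions. -/
theorem monSize_le_size_of_mem_lsubst {s : Term} {k : ℕ} {u : Mon} {r : Term}
    (hr : r ∈ lsubst s k u) : monSize u ≤ r.size := by
  induction s using Term.induction generalizing k u r with
  | var n =>
    rw [lsubst_var] at hr
    change _ ∈ (if n = k then if Multiset.card u = 1 then u else 0
      else if Multiset.card u = 0 then {Term.var (lowerVar k n)} else 0 : FinSum Term) at hr
    split_ifs at hr with h1 h2 h2
    · obtain ⟨v, rfl⟩ := Multiset.card_eq_one.1 h2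
      rw [Multiset.mem_singleton.1 hr]
      simp [monSize]
    · simp at hr
    · rw [Multiset.card_eq_zero.1 h2]; simp
    · simp at hr
  | lam s ih =>
    simp only [lsubst_lam, lamSum, Multiset.mem_map] at hr
    obtain ⟨v, hv, rfl⟩ := hr
    have := ih hv
    rw [monSize_map_shift] at this
    rw [Term.size_lam]
    omega
  | app s t ihs iht =>
    simp only [lsubst_app, appSum, Multiset.mem_bind, Multiset.mem_map] at hr
    obtain ⟨p, hp, a, ha, b, hb, rfl⟩ := hr
    rw [← Multiset.mem_antidiagonal.1 hp, monSize_add, Term.size_app]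
    have h1 := ihs ha
    have h2 := monSize_le_of_mem_lsubstMon (fun s hs u r hr => iht s hs hr) hb
    omega

/-! ### Bounded reduction decreases sizes by at most a bounded factor. -/

theorem MonRed.monSize_le {r : Term → FinSum Term → Prop} {c : ℕ} {t : Mon} {τ : FinSum Mon}
    (h : MonRed (fun s σ => r s σ ∧ ∀ s' ∈ σ, s.size ≤ c * s'.size) t τ) {t' : Mon} (ht : t' ∈ τ) :
    monSize t ≤ c * monSize t' := by
  refine MonRed.induction (p := fun t τ => ∀ t' ∈ τ, monSize t ≤ c * monSize t') ?_
    (fun s σ t τ hs _ ih => ?_) h t' ht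
  · simp
  · simp only [consSum, Multiset.mem_bind, Multiset.mem_map]
    rintro _ ⟨a, ha, b, hb, rfl⟩
    have h1 := hs.2 a ha
    have h2 := ih b hb
    rw [monSize_cons, monSize_cons, mul_add]
    omega

/-- Contraction discards only an abstraction, an application and the replaced variable occurrences,
each level of nesting costing a constant factor. -/
theorem BdTerm.size_le {b : ℕ} {s : Term} {σ : FinSum Term} (h : BdTerm b s σ) :
    ∀ s' ∈ σ, s.size ≤ 4 ^ b * s'.size := by
  have h1 : ∀ b : ℕ, 1 ≤ 4 ^ b := fun b => Nat.one_le_pow _ _ (by omega)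
  refine BdTerm.rec_monRed (p := fun b s σ => ∀ s' ∈ σ, s.size ≤ 4 ^ b * s'.size)
    (fun b i => ?_) (fun b s σ _ ih => ?_) (fun b s σ t τ ih ht => ?_)
    (fun b s σ t τ ih ht => ?_) h
  · simpa using h1 b
  · simp only [lamSum, Multiset.mem_map]
    rintro _ ⟨a, ha, rfl⟩
    have := ih a ha
    have := h1 b
    rw [Term.size_lam, Term.size_lam, mul_add]
    omega
  · simp only [appSum, Multiset.mem_bind, Multiset.mem_map]
    rintro _ ⟨a, ha, t', ht', rfl⟩
    have := ih a ha
    have := ht.monSize_le ht'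
    have := h1 b
    rw [Term.size_app, Term.size_app, mul_add, mul_add]
    omega
  · simp only [lsubstSum, Multiset.mem_bind]
    rintro r ⟨a, ha, t', ht', hr⟩
    have e1 := ih a ha
    have e2 := ht.monSize_le ht'
    have e3 := size_of_mem_lsubst hr
    have e4 := card_le_monSize t'
    have e5 := monSize_le_size_of_mem_lsubst hr
    -- With `c = 4 ^ b`, both `a` and `t'` have size at most `r.size`, so the redex has size at most
    -- `2 * c * r.size + 2`. As `1 ≤ c * r.size`, this is at most `4 * (c * r.size)`, whence the
    -- factor `4`.
    have e6 : 4 ^ b * a.size ≤ 4 ^ b * r.size := Nat.mul_le_mul_left _ (by omega)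
    have e7 : 4 ^ b * monSize t' ≤ 4 ^ b * r.size := Nat.mul_le_mul_left _ e5
    have e8 : 1 * 1 ≤ 4 ^ b * r.size := Nat.mul_le_mul (h1 b) r.size_pos
    rw [Term.size_app, Term.size_lam, pow_succ', mul_assoc]
    omega

/-! ### Finiteness of the set of antecedents of an expression -/

/-- Such a multiset is contained in `N` copies of `A`. -/
theorem finite_multiset_of_card_le {α : Type} {A : Set α} (hA : A.Finite) (N : ℕ) :
    {t : Multiset α | Multiset.card t ≤ N ∧ ∀ a ∈ t, a ∈ A}.Finite := by
  classical
  refine (Multiset.finite_toSet (Multiset.powerset (N • hA.toFinset.val))).subset ?_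
  rintro t ⟨hN, ht⟩
  simp only [Set.mem_ofPred_eq, Multiset.mem_powerset]
  refine Multiset.le_iff_count.2 fun a => ?_
  by_cases ha : a ∈ t
  · rw [Multiset.count_nsmul, Multiset.count_eq_one_of_mem hA.toFinset.nodup
      (by simpa using ht a ha), mul_one]
    exact (Multiset.count_le_card a t).trans hN
  · rw [Multiset.count_eq_zero_of_notMem ha]
    exact Nat.zero_le _

theorem size_le_monSize {t : Mon} {s : Term} (h : s ∈ t) : s.size ≤ monSize t :=
  Multiset.single_le_sum (fun _ _ => Nat.zero_le _) _ (Multiset.mem_map_of_mem _ h)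

/-- Terms have positive size, so a bound on size also bounds the number of arguments of an
application. -/
theorem finite_term_of_size_le (N : ℕ) : ∀ {V : Set ℕ}, V.Finite →
    {s : Term | s.size ≤ N ∧ s.fv ⊆ V}.Finite := by
  induction N with
  | zero =>
    intro V _
    convert Set.finite_empty
    ext s
    simpa using fun h => (s.size_pos.ne' h).elim
  | succ N ih =>
    intro V hV
    -- The body of an abstraction may also use the bound index `0`, the others being raised by one.
    have hL : {n : ℕ | n = 0 ∨ n - 1 ∈ V}.Finite := by
      refine ((Set.finite_singleton 0).union (hV.image Nat.succ)).subset ?_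
      rintro (_ | n) hn
      · exact .inl rfl
      · exact .inr ⟨n, by simpa using hn, rfl⟩
    refine ((hV.image Term.var).union (((ih hL).image Term.lam).union
      (Set.Finite.image2 Term.app (ih hV) (finite_multiset_of_card_le (ih hV) N)))).subset ?_
    rintro s ⟨hs, hf⟩
    rcases s.exists_constructor with ⟨n, rfl⟩ | ⟨s, rfl⟩ | ⟨s, t, rfl⟩
    · rw [Term.fv_var] at hf
      exact .inl ⟨n, hf rfl, rfl⟩
    · rw [Term.fv_lam] at hf
      rw [Term.size_lam] at hs
      refine .inr (.inl ⟨s, ⟨by omega, fun n hn => ?_⟩, rfl⟩)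
      cases n with
      | zero => exact .inl rfl
      | succ n => exact .inr (hf hn)
    · rw [Term.fv_app] at hf
      rw [Term.size_app] at hs
      have := card_le_monSize t
      refine .inr (.inr ⟨s, ⟨by omega, fun n hn => hf (.inl hn)⟩, t, ⟨by omega, fun u hu =>
        ⟨?_, fun n hn => hf (.inr ⟨u, hu, hn⟩)⟩⟩, rfl⟩)
      have := size_le_monSize hu
      omega

/-- Among expressions with finitely many free variables altogether, only finitely many have a reduct of
nesting at most `b` with a given expression in its support. -/
theorem finite_antecedents (b : ℕ) (κ : Kind) {E : Set (Expr κ)} (hE : (fvSet E).Finite)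
    (e' : Expr κ) : {e | e ∈ E ∧ ∃ ε, Bd b κ e ε ∧ e' ∈ ε}.Finite := by
  have hfv : ∀ e ∈ E, fv κ e ⊆ fvSet E := fun e he => Set.subset_biUnion_of_mem he
  cases κ with
  | term =>
    refine (finite_term_of_size_le (4 ^ b * Term.size e') hE).subset ?_
    rintro e ⟨he, ε, hε, he'⟩
    exact ⟨BdTerm.size_le hε e' he', hfv e he⟩
  | mon =>
    refine (finite_multiset_of_card_le (finite_term_of_size_le (4 ^ b * monSize e') hE)
      (4 ^ b * monSize e')).subset ?_
    rintro e ⟨he, ε, hε, he'⟩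
    have hle : monSize e ≤ 4 ^ b * monSize e' :=
      MonRed.monSize_le (MonRed.mono (fun s σ hs => ⟨hs, hs.size_le⟩) hε) he'
    exact ⟨(card_le_monSize e).trans hle, fun s hs => ⟨(size_le_monSize hs).trans hle,
      fun n hn => hfv e he ⟨s, hs, hn⟩⟩⟩

/-! ### Finite forms of the additive splitting property -/

section Splitting

variable {S : Type*} [CommSemiring S]

/-- Nonemptiness of `t` matters: `a₁ + a₂ = 0` need not make `a₁` and `a₂` zero. -/
theorem AdditiveSplitting.add_eq_sum (hS : AdditiveSplitting S) {J : Type*} {t : Finset J}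
    (ht : t.Nonempty) {b : J → S} {a₁ a₂ : S} (h : a₁ + a₂ = ∑ j ∈ t, b j) :
    ∃ c d : J → S, a₁ = ∑ j ∈ t, c j ∧ a₂ = ∑ j ∈ t, d j ∧ ∀ j ∈ t, b j = c j + d j := by
  classical
  induction ht using Finset.Nonempty.cons_induction generalizing a₁ a₂ with
  | singleton j => exact ⟨fun _ => a₁, fun _ => a₂, by simp, by simp, by simpa using h.symm⟩
  | cons j t hj _ ih =>
    rw [Finset.sum_cons] at h
    obtain ⟨c₁, c₂, d₁, d₂, rfl, rfl, h₁, h₂⟩ := hS _ _ _ _ h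
    obtain ⟨c, d, rfl, rfl, hb⟩ := ih h₂.symm
    have ne : ∀ i ∈ t, i ≠ j := fun i hi hij => hj (hij ▸ hi)
    refine ⟨Function.update c j c₁, Function.update d j d₁, ?_, ?_, fun i hi => ?_⟩
    · rw [Finset.sum_cons, Function.update_self]
      exact congrArg _ (Finset.sum_congr rfl fun i hi => by rw [Function.update_of_ne (ne i hi)])
    · rw [Finset.sum_cons, Function.update_self]
      exact congrArg _ (Finset.sum_congr rfl fun i hi => by rw [Function.update_of_ne (ne i hi)])
    · rcases Finset.mem_cons.1 hi with rfl | hi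
      · rw [Function.update_self, Function.update_self, h₁]
      · rw [Function.update_of_ne (ne i hi), Function.update_of_ne (ne i hi), hb i hi]

theorem AdditiveSplitting.sum_eq_sum (hS : AdditiveSplitting S) {I J : Type*} {s : Finset I}
    {t : Finset J} (hs : s.Nonempty) (ht : t.Nonempty) {a : I → S} {b : J → S}
    (h : ∑ i ∈ s, a i = ∑ j ∈ t, b j) :
    ∃ c : I → J → S, (∀ i ∈ s, a i = ∑ j ∈ t, c i j) ∧ ∀ j ∈ t, b j = ∑ i ∈ s, c i j := by
  classical
  induction hs using Finset.Nonempty.cons_induction generalizing b with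
  | singleton i => exact ⟨fun _ => b, by simpa using h, by simp⟩
  | cons i s hi _ ih =>
    rw [Finset.sum_cons] at h
    obtain ⟨c, d, h₁, h₂, hb⟩ := hS.add_eq_sum ht h
    obtain ⟨m, hm₁, hm₂⟩ := ih h₂
    have ne : ∀ i' ∈ s, i' ≠ i := fun i' hi' e => hi (e ▸ hi')
    refine ⟨Function.update m i c, fun i' hi' => ?_, fun j hj => ?_⟩
    · rcases Finset.mem_cons.1 hi' with rfl | hi'
      · rw [Function.update_self, h₁]
      · rw [Function.update_of_ne (ne i' hi'), hm₁ i' hi']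
    · rw [Finset.sum_cons, Function.update_self, hb j hj, hm₂ j hj]
      exact congrArg _ (Finset.sum_congr rfl fun i' hi' => by rw [Function.update_of_ne (ne i' hi')])

/-- Finitely many decompositions of the same scalar have a common refinement. -/
theorem AdditiveSplitting.exists_refinement (hS : AdditiveSplitting S) {n : ℕ} {I : Fin n → Type}
    [∀ k, Fintype (I k)] [∀ k, DecidableEq (I k)] [∀ k, Nonempty (I k)] {a : ∀ k, I k → S} {v : S}
    (h : ∀ k, ∑ i, a k i = v) :
    ∃ c : (∀ k, I k) → S, ∑ j, c j = v ∧ ∀ k i, a k i = ∑ j, if j k = i then c j else 0 := by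
  induction n with
  | zero => exact ⟨fun _ => v, by simp, fun k => k.elim0⟩
  | succ n ih =>
    obtain ⟨c, hc, hca⟩ := ih (I := fun k => I k.succ) (a := fun k => a k.succ) fun k => h k.succ
    -- The first decomposition is split against the refinement `c` of the others; a multi-index is
    -- then read as a head and a tail.
    obtain ⟨m, hm₁, hm₂⟩ := hS.sum_eq_sum (s := Finset.univ) (t := Finset.univ)
      Finset.univ_nonempty Finset.univ_nonempty ((h 0).trans hc.symm)
    have key : ∀ F : (∀ k, I k) → S, ∑ j, F j = ∑ x, ∑ y, F (Fin.cons x y) := fun F => by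
      rw [← (Fin.consEquiv I).sum_comp, Fintype.sum_prod_type]
      rfl
    refine ⟨fun j => m (j 0) (Fin.tail j), ?_, fun k i => ?_⟩
    · rw [key, ← h 0]
      exact Finset.sum_congr rfl fun x _ => by simp [hm₁ x (Finset.mem_univ x)]
    · rw [key]
      induction k using Fin.cases with
      | zero =>
        rw [Finset.sum_eq_single i (fun x _ hx => by simp [hx]) (by simp)]
        simp [hm₁ i (Finset.mem_univ i)]
      | succ k =>
        rw [hca k i, Finset.sum_comm]
        refine Finset.sum_congr rfl fun y _ => ?_
        simp only [Fin.cons_succ, Fin.cons_zero, Fin.tail_cons]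
        split_ifs
        · exact hm₂ y (Finset.mem_univ y)
        · simp

end Splitting

/-! ### Reindexing of linear combinations -/

section LinComb

variable {S : Type*} [CommSemiring S] {X I J : Type}

open Classical in
theorem linComb_eq_sum (a : I → S) {ξ : I → FinSum X} {x : X} {s : Finset I}
    (hs : ∀ i, x ∈ ξ i → i ∈ s) : linComb a ξ x = ∑ i ∈ s, a i * (Multiset.count x (ξ i) : S) := by
  refine finsum_eq_sum_of_support_subset _ fun i hi => ?_
  by_contra hn
  refine hi ?_
  beta_reduce
  rw [Multiset.count_eq_zero_of_notMem fun hx => hn (hs i hx), Nat.cast_zero, mul_zero]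

/-- The coefficients `a` are the sums of the coefficients `c` over the fibres of `π`. -/
structure IsRefinement (π : J → I) (a : I → S) (c : J → S) : Prop where
  finite : ∀ i, (π ⁻¹' {i}).Finite
  sum_eq : ∀ i, a i = ∑ j ∈ (finite i).toFinset, c j

theorem IsRefinement.summableFam {π : J → I} {a : I → S} {c : J → S} (h : IsRefinement π a c)
    {ξ : I → FinSum X} (hξ : SummableFam ξ) : SummableFam fun j => ξ (π j) := by
  intro x
  exact (hξ x).preimage' fun i _ => h.finite i

theorem IsRefinement.linComb_eq {π : J → I} {a : I → S} {c : J → S} (h : IsRefinement π a c)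
    {ξ : I → FinSum X} (hξ : SummableFam ξ) : linComb c (fun j => ξ (π j)) = linComb a ξ := by
  classical
  funext x
  rw [linComb_eq_sum a (s := (hξ x).toFinset) fun i hi => by simpa using hi,
    linComb_eq_sum c (s := (h.summableFam hξ x).toFinset) fun i hi => by simpa using hi,
    ← Finset.sum_fiberwise_of_maps_to (t := (hξ x).toFinset) (g := π) (by simp)]
  refine Finset.sum_congr rfl fun i hi => ?_
  rw [h.sum_eq i, Finset.sum_mul]
  refine Finset.sum_congr ?_ fun j hj => ?_
  · ext j
    have hi' : x ∈ ξ i := by simpa using hi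
    simp only [Finset.mem_filter, Set.Finite.mem_toFinset, Set.mem_preimage, Set.mem_singleton_iff]
    exact ⟨fun hj => hj.2, fun hj => ⟨by subst hj; exact hi', hj⟩⟩
  · have : π j = i := by simpa using hj
    rw [this]

theorem summableFam_sigma {m : J → ℕ} {ξ : J → FinSum X} {y : ∀ j, Fin (m j) → FinSum X}
    (h : ∀ j, ξ j = ∑ l, y j l) (hξ : SummableFam ξ) :
    SummableFam fun p : Σ j, Fin (m j) => y p.1 p.2 := by
  intro x
  refine (((hξ x).toFinset.sigma fun j => (Finset.univ : Finset (Fin (m j)))).finite_toSet).subset ?_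
  rintro ⟨j, l⟩ hp
  simp only [Finset.coe_sigma, Set.mem_sigma_iff, Finset.mem_coe, Set.Finite.mem_toFinset,
    Finset.mem_univ, and_true]
  change x ∈ ξ j
  rw [h j, Multiset.mem_sum]
  exact ⟨l, Finset.mem_univ l, hp⟩

theorem linComb_sigma {m : J → ℕ} {ξ : J → FinSum X} {y : ∀ j, Fin (m j) → FinSum X}
    (h : ∀ j, ξ j = ∑ l, y j l) (hξ : SummableFam ξ) (c : J → S) :
    linComb (fun p : Σ j, Fin (m j) => c p.1) (fun p => y p.1 p.2) = linComb c ξ := by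
  classical
  funext x
  have mem : ∀ (j : J) (l : Fin (m j)), x ∈ y j l → x ∈ ξ j := fun j l hx => by
    rw [h j, Multiset.mem_sum]
    exact ⟨l, Finset.mem_univ l, hx⟩
  rw [linComb_eq_sum c (s := (hξ x).toFinset) fun i hi => by simpa using hi,
    linComb_eq_sum _ (s := (hξ x).toFinset.sigma fun j => Finset.univ) fun p hp => by
      simpa using mem p.1 p.2 hp, Finset.sum_sigma]
  refine Finset.sum_congr rfl fun j _ => ?_
  rw [h j, Multiset.count_sum', Nat.cast_sum, Finset.mul_sum]

theorem sum_fibre_eq {a : I → S} {e : I → X} {x : X} [Fintype {i // e i = x}] :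
    ∑ i : {i // e i = x}, a i = linComb a (fun i => {e i}) x := by
  classical
  rw [linComb_eq_sum a (s := Finset.univ.map (Function.Embedding.subtype fun i => e i = x))
    (fun i hi => by simpa [eq_comm] using hi), Finset.sum_map]
  refine Finset.sum_congr rfl fun i _ => ?_
  simp [i.2]

theorem exists_mem_of_linComb_ne_zero {a : I → S} {ξ : I → FinSum X} {x : X}
    (h : linComb a ξ x ≠ 0) : ∃ i, x ∈ ξ i := by
  classical
  by_contra hn
  refine h ?_
  rw [linComb_eq_sum a (s := ∅) fun i hi => (hn ⟨i, hi⟩).elim, Finset.sum_empty]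

/-- The summands become indices, so that they can serve in a new linear combination. -/
theorem LinRed.exists_family {r : X → FinSum X → Prop} {ξ φ : FinSum X} (h : LinRed r ξ φ) :
    ∃ (m : ℕ) (x : Fin m → X) (ψ : Fin m → FinSum X), ξ = ∑ l, {x l} ∧ φ = ∑ l, ψ l ∧
      ∀ l, r (x l) (ψ l) := by
  induction h with
  | zero => exact ⟨0, Fin.elim0, Fin.elim0, by simp, by simp, fun l => l.elim0⟩
  | @add x φ ξ ψ hx _ ih =>
    obtain ⟨m, y, χ, rfl, rfl, h⟩ := ih
    refine ⟨m + 1, Fin.cons x y, Fin.cons φ χ, ?_, ?_, fun l => ?_⟩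
    · simp [Fin.sum_univ_succ]
    · simp [Fin.sum_univ_succ]
    · induction l using Fin.cases with
      | zero => simpa using hx
      | succ l => simpa using h l

end LinComb

/-! ### From a relation on expressions to a relation on vectors -/

section Vectors

variable {S : Type*} [CommSemiring S] {X : Type}

/-- The vectors `v` and `v'` are the linear combinations, with the same coefficients, of a summable
family `e` of elements of `A` and of a summable family `η` of finite sums with `r (e i) (η i)`. -/
def SplitOn (r : X → FinSum X → Prop) (A : Set X) (v v' : X → S) : Prop :=
  ∃ (I : Type) (a : I → S) (e : I → X) (η : I → FinSum X),
    (∀ i, e i ∈ A) ∧ SummableFam (fun i => ({e i} : FinSum X)) ∧ v = linComb a (fun i => {e i}) ∧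
    SummableFam η ∧ v' = linComb a η ∧ ∀ i, r (e i) (η i)

/-- The reducts of the elements of `A`. -/
def reducts (r : X → FinSum X → Prop) (A : Set X) : Set X :=
  {y | ∃ x ∈ A, ∃ ξ, r x ξ ∧ y ∈ ξ}

/-- The added indices have empty fibres, so their coefficient `0` is an empty sum. -/
theorem isRefinement_inl {I J : Type} (a : I → S) :
    IsRefinement (Sum.inl : I → I ⊕ J) (Sum.elim a 0) a where
  finite i := Set.Finite.preimage Sum.inl_injective.injOn (Set.finite_singleton i)
  sum_eq i := by
    rcases i with i | j
    · rw [Finset.sum_eq_single i] <;> simp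
    · simp only [Sum.elim_inr, Pi.zero_apply]
      refine (Finset.sum_eq_zero fun i hi => ?_).symm
      simp at hi

theorem summableFam_sumElim {I J : Type} {ξ : I → FinSum X} {ψ : J → FinSum X}
    (hξ : SummableFam ξ) (hψ : SummableFam ψ) : SummableFam (Sum.elim ξ ψ) := by
  intro x
  refine (((hξ x).image Sum.inl).union ((hψ x).image Sum.inr)).subset ?_
  rintro (i | j) h
  · exact .inl ⟨i, h, rfl⟩
  · exact .inr ⟨j, h, rfl⟩

/-- The witnesses of `SplitOn` may be padded with trivial steps so as to cover all of `A`. -/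
theorem SplitOn.exists_covering {r : X → FinSum X → Prop} {A : Set X} {v v' : X → S}
    (hr : ∀ x ∈ A, r x {x}) (h : SplitOn r A v v') :
    ∃ (I : Type) (a : I → S) (e : I → X) (η : I → FinSum X),
      (∀ i, e i ∈ A) ∧ SummableFam (fun i => ({e i} : FinSum X)) ∧
      v = linComb a (fun i => {e i}) ∧ SummableFam η ∧ v' = linComb a η ∧ (∀ i, r (e i) (η i)) ∧
      ∀ x ∈ A, ∃ i, e i = x := by
  obtain ⟨I, a, e, η, heA, he, rfl, hη, rfl, hstep⟩ := h
  have hid : SummableFam fun x : A => ({x.1} : FinSum X) := fun x =>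
    Set.Subsingleton.finite fun y hy z hz => Subtype.ext
      ((Multiset.mem_singleton.1 hy).symm.trans (Multiset.mem_singleton.1 hz))
  have hη' := summableFam_sumElim hη hid
  have he' : SummableFam fun i : I ⊕ A => ({Sum.elim e Subtype.val i} : FinSum X) := by
    convert summableFam_sumElim he hid using 1
    funext i
    cases i <;> rfl
  refine ⟨I ⊕ A, Sum.elim a 0, Sum.elim e Subtype.val, Sum.elim η fun x => {x.1}, ?_, he', ?_, hη',
    ?_, ?_, fun x hx => ⟨.inr ⟨x, hx⟩, rfl⟩⟩
  · rintro (i | x)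
    · exact heA i
    · exact x.2
  · exact (isRefinement_inl a).linComb_eq he'
  · exact (isRefinement_inl a).linComb_eq hη'
  · rintro (i | x)
    · exact hstep i
    · exact hr x x.2

/-- Decompositions of the same vector along families with the same range have a common refinement. -/
theorem AdditiveSplitting.exists_common_refinement (hS : AdditiveSplitting S) {n : ℕ}
    {A : Set X} {v : X → S} {I : Fin n → Type} {a : ∀ k, I k → S} {e : ∀ k, I k → X}
    (heA : ∀ k i, e k i ∈ A) (hA : ∀ k, ∀ x ∈ A, ∃ i, e k i = x)
    (he : ∀ k, SummableFam fun i => ({e k i} : FinSum X))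
    (hv : ∀ k, v = linComb (a k) fun i => {e k i}) :
    ∃ (J : Type) (c : J → S) (x : J → X) (π : ∀ k, J → I k),
      (∀ j, x j ∈ A) ∧ (∀ k j, e k (π k j) = x j) ∧ ∀ k, IsRefinement (π k) (a k) c := by
  classical
  have hfin : ∀ k x, Finite {i // e k i = x} := fun k x =>
    ((he k x).subset fun i hi => by simpa [eq_comm] using hi : {i | e k i = x}.Finite)
  have hfin' : ∀ k x, Fintype {i // e k i = x} := fun k x => Fintype.ofFinite _
  -- Covering is needed here: if one family had no index over `x`, the product of the fibres would
  -- be empty and would lose the indices of the other families over `x`, whose coefficients may be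
  -- nonzero with sum `0`.
  have hne : ∀ k (x : A), Nonempty {i // e k i = x} := fun k x =>
    let ⟨i, hi⟩ := hA k x x.2; ⟨⟨i, hi⟩⟩
  have href : ∀ x : A, ∃ c : (∀ k, {i // e k i = x}) → S, ∑ j, c j = v x ∧
      ∀ k (i : {i // e k i = x}), a k i = ∑ j, if j k = i then c j else 0 := fun x =>
    hS.exists_refinement (a := fun k (i : {i // e k i = x}) => a k i) (v := v x) fun k =>
      sum_fibre_eq.trans (congrFun (hv k) x).symm
  choose c _ hc using href
  -- A new index over `x` is a choice, for every `k`, of one old index over `x`.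
  refine ⟨Σ x : A, ∀ k, {i // e k i = x}, fun p => c p.1 p.2, fun p => p.1, fun k p => (p.2 k).1,
    fun p => p.1.2, fun k p => (p.2 k).2, fun k => ?_⟩
  have hfibre : ∀ i, (fun p : Σ x : A, ∀ k, {i // e k i = x} => (p.2 k).1) ⁻¹' {i} =
      (((Finset.univ : Finset (∀ k', {i' // e k' i' = e k i})).filter
        fun j => j k = ⟨i, rfl⟩).map
          (Function.Embedding.sigmaMk (β := fun x : A => ∀ k, {i // e k i = x})
            ⟨e k i, heA k i⟩) : Finset _) := by
    intro i
    ext ⟨⟨x, hxA⟩, j⟩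
    simp only [Set.mem_preimage, Set.mem_singleton_iff, Finset.coe_map, Set.mem_image,
      Finset.mem_coe, Finset.mem_filter, Finset.mem_univ, true_and]
    constructor
    · intro hi
      obtain rfl : e k i = x := by rw [← hi]; exact (j k).2
      exact ⟨j, Subtype.ext hi, rfl⟩
    · rintro ⟨j', hj', h⟩
      cases h
      exact congrArg Subtype.val hj'
  have hf : ∀ i, ((fun p : Σ x : A, ∀ k, {i // e k i = x} => (p.2 k).1) ⁻¹' {i}).Finite :=
    fun i => by rw [hfibre i]; exact Finset.finite_toSet _
  refine ⟨hf, fun i => ?_⟩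
  rw [Finset.coe_injective ((hf i).coe_toFinset.trans (hfibre i)), Finset.sum_map,
    Finset.sum_filter]
  exact hc ⟨e k i, heA k i⟩ k ⟨i, rfl⟩

/-- On the common refinement, each index carries an expression with one reduct per `k`, and `conf`
joins these. The support clause asks for an element of `Fin n` because for `n = 0` nothing relates
the sums `φ j` to `A`. -/
theorem AdditiveSplitting.exists_common_target (hS : AdditiveSplitting S) {n : ℕ}
    {r r' : X → FinSum X → Prop} {A : Set X} (hr : ∀ x ∈ A, r x {x})
    (conf : ∀ x ∈ A, ∀ ξ : Fin n → FinSum X, (∀ k, r x (ξ k)) → ∃ φ, ∀ k, LinRed r' (ξ k) φ)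
    (hfin : ∀ y, {x | ∃ φ, r' x φ ∧ y ∈ φ}.Finite) {v : X → S} {v' : Fin n → X → S}
    (h : ∀ k, SplitOn r A v (v' k)) :
    ∃ w : X → S, (∀ (_ : Fin n), Function.support w ⊆ reducts r' (reducts r A)) ∧
      ∀ k, SplitOn r' (reducts r A) (v' k) w := by
  choose I a e η heA he hv hη hv' hstep hA using fun k => (h k).exists_covering hr
  obtain ⟨J, c, x, π, hxA, hx, hπ⟩ := hS.exists_common_refinement heA hA he hv
  have hstep' : ∀ k j, r (x j) (η k (π k j)) := fun k j => hx k j ▸ hstep k (π k j)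
  choose φ hφ using fun j => conf (x j) (hxA j) (fun k => η k (π k j)) fun k => hstep' k j
  choose m y ψ hy hψ hred using fun k j => (hφ j k).exists_family
  have hmem : ∀ k j z, z ∈ φ j → ∃ l, z ∈ ψ k j l := fun k j z hz => by
    rw [hψ k j, Multiset.mem_sum] at hz
    obtain ⟨l, -, hl⟩ := hz
    exact ⟨l, hl⟩
  have hymem : ∀ k j l, y k j l ∈ η k (π k j) := fun k j l => by
    rw [hy k j, Multiset.mem_sum]
    exact ⟨l, Finset.mem_univ l, Multiset.mem_singleton_self _⟩
  have hyB : ∀ k j l, y k j l ∈ reducts r A := fun k j l =>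
    ⟨x j, hxA j, _, hstep' k j, hymem k j l⟩
  have hη' : ∀ k, SummableFam fun j => η k (π k j) := fun k => (hπ k).summableFam (hη k)
  -- If `z` is in `φ j`, it comes from a summand of `η k (π k j)`. There are finitely many such
  -- antecedents of `z`, each in `η k (π k j)` for finitely many `j`.
  have hφs : ∀ _ : Fin n, SummableFam φ := fun k z => by
    refine ((hfin z).biUnion fun t _ => hη' k t).subset fun j hj => ?_
    obtain ⟨l, hl⟩ := hmem k j z hj
    exact Set.mem_biUnion (x := y k j l) ⟨_, hred k j l, hl⟩ (hymem k j l)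
  refine ⟨linComb c φ, fun k z hz => ?_, fun k => ?_⟩
  · obtain ⟨j, hj⟩ := exists_mem_of_linComb_ne_zero hz
    obtain ⟨l, hl⟩ := hmem k j z hj
    exact ⟨y k j l, hyB k j l, _, hred k j l, hl⟩
  -- The second reduction is indexed by the summands of all the `η k (π k j)`, each keeping the
  -- coefficient `c j`.
  · refine ⟨Σ j, Fin (m k j), fun p => c p.1, fun p => y k p.1 p.2, fun p => ψ k p.1 p.2,
      fun p => hyB k p.1 p.2, summableFam_sigma (hy k) (hη' k), ?_,
      summableFam_sigma (hψ k) (hφs k), ?_, fun p => hred k p.1 p.2⟩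
    · rw [linComb_sigma (hy k) (hη' k), hv' k]
      exact ((hπ k).linComb_eq (hη k)).symm
    · rw [linComb_sigma (hψ k) (hφs k)]

end Vectors

/-! ### Confluence -/

section Confluence

variable {S : Type*} [CommSemiring S] {κ : Kind}

/-- That each element of `A` has a reduct serves to obtain reflexivity on `A` for relations
restricted to a set of sources. -/
theorem SplitRed.splitOn {r : Expr κ → FinSum (Expr κ) → Prop} {ε ε' : ResourceVector S κ}
    (h : SplitRed r ε ε') :
    ∃ A : Set (Expr κ), (fvSet A).Finite ∧ (∀ x ∈ A, ∃ ξ, r x ξ) ∧ SplitOn r A ε.1 ε'.1 := by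
  obtain ⟨I, a, e, η, hfv, he, h₁, hη, h₂, hr⟩ := h
  refine ⟨Set.range e, hfv, ?_, I, a, e, η, fun i => ⟨i, rfl⟩, he, h₁, hη, h₂, hr⟩
  rintro _ ⟨i, rfl⟩
  exact ⟨_, hr i⟩

theorem SplitOn.mono {X : Type} {r r' : X → FinSum X → Prop} (hr : ∀ x ξ, r x ξ → r' x ξ)
    {A A' : Set X} (hA : A ⊆ A') {v v' : X → S} (h : SplitOn r A v v') : SplitOn r' A' v v' := by
  obtain ⟨I, a, e, η, heA, he, h₁, hη, h₂, hstep⟩ := h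
  exact ⟨I, a, e, η, fun i => hA (heA i), he, h₁, hη, h₂, fun i => hr _ _ (hstep i)⟩

theorem fvSet_mono {E F : Set (Expr κ)} (h : E ⊆ F) : fvSet E ⊆ fvSet F :=
  Set.biUnion_subset_biUnion_left h

theorem SplitOn.splitRed {r : Expr κ → FinSum (Expr κ) → Prop} {A : Set (Expr κ)}
    {ε ε' : ResourceVector S κ} (hA : (fvSet A).Finite) (h : SplitOn r A ε.1 ε'.1) :
    SplitRed r ε ε' := by
  obtain ⟨I, a, e, η, heA, he, h₁, hη, h₂, hstep⟩ := h
  exact ⟨I, a, e, η, hA.subset (fvSet_mono (Set.range_subset_iff.2 heA)), he, h₁, hη, h₂, hstep⟩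

/-- The relations are kept abstract so that both variants of the reduction of vectors are instances;
they differ only in how reflexive steps are restricted. -/
theorem AdditiveSplitting.splitRed_confluent (hS : AdditiveSplitting S) {n : ℕ}
    {q : Fin n → Expr κ → FinSum (Expr κ) → Prop} {r r' : Expr κ → FinSum (Expr κ) → Prop}
    (hq : ∀ k x ξ, q k x ξ → r x ξ) (hr : ∀ x ξ, r x ξ → r x {x})
    (conf : ∀ x, ∀ ξ : Fin n → FinSum (Expr κ), (∀ k, r x (ξ k)) → ∃ φ, ∀ k, LinRed r' (ξ k) φ)
    (hfin : ∀ y, {x | ∃ φ, r' x φ ∧ y ∈ φ}.Finite)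
    (hfv : ∀ A : Set (Expr κ), (fvSet A).Finite → (fvSet (reducts r A)).Finite)
    (hfv' : ∀ A : Set (Expr κ), (fvSet A).Finite → (fvSet (reducts r' A)).Finite)
    {ε : ResourceVector S κ} {ε' : Fin n → ResourceVector S κ}
    (h : ∀ k, SplitRed (q k) ε (ε' k)) :
    ∃ ε'' : ResourceVector S κ, ∀ k, SplitRed r' (ε' k) ε'' := by
  -- With no reduct to join, any vector will do, and summability of the `φ j` is not available.
  cases n with
  | zero =>
    refine ⟨⟨0, ?_⟩, fun k => k.elim0⟩
    simp [fvSet]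
  | succ n =>
    choose A hA hAr hsplit using fun k => (h k).splitOn
    have hU : (fvSet (⋃ k, A k)).Finite := by
      rw [fvSet, Set.biUnion_iUnion]
      exact Set.finite_iUnion hA
    obtain ⟨w, hw, hsplit'⟩ := hS.exists_common_target (r := r) (r' := r') (A := ⋃ k, A k)
      (fun x hx => by
        obtain ⟨k, hk⟩ := Set.mem_iUnion.1 hx
        obtain ⟨ξ, hξ⟩ := hAr k x hk
        exact hr x ξ (hq k x ξ hξ))
      (fun x _ => conf x) hfin
      (fun k => (hsplit k).mono (hq k) (Set.subset_iUnion A k))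
    exact ⟨⟨w, (hfv' _ (hfv _ hU)).subset (fvSet_mono (hw 0))⟩,
      fun k => (hsplit' k).splitRed (hfv _ hU)⟩

theorem IsResourceStructure.iUnion_mem {𝔈 : Set (Set (Expr κ))} (h𝔈 : IsResourceStructure 𝔈)
    {n : ℕ} {E : Fin n → Set (Expr κ)} (hE : ∀ k, E k ∈ 𝔈) : (⋃ k, E k) ∈ 𝔈 := by
  induction n with
  | zero =>
    rw [Set.iUnion_of_empty]
    exact h𝔈.finite_mem _ Set.finite_empty (by simp [fvSet])
  | succ n ih =>
    have : (⋃ k, E k) = E 0 ∪ ⋃ k : Fin n, E k.succ := by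
      ext x
      simp [Fin.exists_fin_succ]
    rw [this]
    exact h𝔈.union_mem _ (hE 0) _ (ih fun k => hE k.succ)

theorem fvSet_union (E F : Set (Expr κ)) : fvSet (E ∪ F) = fvSet E ∪ fvSet F :=
  Set.biUnion_union _ _ _

/-- The reducts of elements of `E` for the reflexive closure of parallel reduction. -/
def parReducts (E : Set (Expr κ)) : Set (Expr κ) :=
  {e' | ∃ e ∈ E, ∃ ε', ReflStep (Par κ) e ε' ∧ e' ∈ ε'}

theorem reflStep_bd {b : ℕ} {e : Expr κ} {ε : FinSum (Expr κ)} (h : ReflStep (Bd b κ) e ε) :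
    Bd b κ e ε := by
  rcases h with h | rfl
  · exact h
  · exact Bd.refl b κ e

/-- Reducts of `e ∈ E` have a common reduct, obtained by reducing elements of `parReducts E`. -/
theorem Bd.exists_common_reduct {n b : ℕ} {E : Set (Expr κ)} {e : Expr κ} (he : e ∈ E)
    {ξ : Fin n → FinSum (Expr κ)} (h : ∀ k, Bd b κ e (ξ k)) :
    ∃ φ, ∀ k, LinRed (RestrictTo (Bd (2 ^ (n * b)) κ) (parReducts E)) (ξ k) φ := by
  obtain ⟨φ, hφ⟩ := commonReduct_expr κ e (fun _ => b) ξ h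
  refine ⟨φ, fun k => (hφ k).mono fun x hx ψ hψ => ⟨⟨e, he, _, .inl (h k).par, hx⟩, ?_⟩⟩
  simpa using hψ

theorem bdRed_confluent (hS : AdditiveSplitting S) {𝔈 : Set (Set (Expr κ))}
    (h𝔈 : IsReductionStructure (Par κ) 𝔈) {n : ℕ} {ε : ResourceVector S κ}
    {ε' : Fin n → ResourceVector S κ} (h : ∀ k, BdRed 𝔈 ε (ε' k)) :
    ∃ ε'' : ResourceVector S κ, ∀ k, BdRed 𝔈 (ε' k) ε'' := by
  choose b E hE hsplit using h
  have hU := h𝔈.iUnion_mem hE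
  set U := ⋃ k, E k
  have hU' : parReducts U ∈ 𝔈 := h𝔈.reducts_mem U hU
  -- Sources are restricted to `F`, so all reducts lie in the member of `𝔈` given by closure of `F`,
  -- whatever `A` is.
  have hfv : ∀ (c : ℕ), ∀ F ∈ 𝔈, ∀ A : Set (Expr κ),
      (fvSet (reducts (RestrictTo (ReflStep (Bd c κ)) F) A)).Finite := fun c F hF A => by
    refine (h𝔈.finite_fv _ (h𝔈.reducts_mem F hF)).subset (fvSet_mono ?_)
    rintro y ⟨x, -, ξ, ⟨hxF, hξ⟩, hy⟩
    exact ⟨x, hxF, ξ, .inl (reflStep_bd hξ).par, hy⟩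
  obtain ⟨ε'', hε''⟩ := hS.splitRed_confluent
    (r := RestrictTo (ReflStep (Bd (∑ k, b k) κ)) U)
    (r' := RestrictTo (ReflStep (Bd (2 ^ (n * ∑ k, b k)) κ)) (parReducts U))
    (fun k x ξ hx => ⟨Set.mem_iUnion.2 ⟨k, hx.1⟩, .inl ((reflStep_bd hx.2).mono
      (Finset.single_le_sum (fun _ _ => Nat.zero_le _) (Finset.mem_univ k)))⟩)
    (fun x ξ hx => ⟨hx.1, .inr rfl⟩)
    (fun x ξ hx => by
      by_cases hxU : x ∈ U
      · obtain ⟨φ, hφ⟩ := Bd.exists_common_reduct hxU (ξ := ξ) fun k => reflStep_bd (hx k).2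
        exact ⟨φ, fun k => (hφ k).mono fun _ _ _ h => ⟨h.1, .inl h.2⟩⟩
      -- An expression outside `U` has no reduct here, so `0` is a dummy value.
      · exact ⟨0, fun k => (hxU (hx k).1).elim⟩)
    (fun y => by
      refine (finite_antecedents (2 ^ (n * ∑ k, b k)) κ (h𝔈.finite_fv _ hU') y).subset ?_
      rintro x ⟨φ, ⟨hx, hφ⟩, hy⟩
      exact ⟨hx, φ, reflStep_bd hφ, hy⟩)
    (fun A _ => hfv _ _ hU A) (fun A _ => hfv _ _ hU' A) hsplit
  exact ⟨ε'', fun k => ⟨_, _, hU', hε'' k⟩⟩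

theorem bdRedLoose_confluent (hS : AdditiveSplitting S) {𝔈 : Set (Set (Expr κ))}
    (h𝔈 : IsReductionStructure (Par κ) 𝔈) {n : ℕ} {ε : ResourceVector S κ}
    {ε' : Fin n → ResourceVector S κ} (h : ∀ k, BdRedLoose 𝔈 ε (ε' k)) :
    ∃ ε'' : ResourceVector S κ, ∀ k, BdRedLoose 𝔈 (ε' k) ε'' := by
  choose b E hE hsplit using h
  have hU := h𝔈.iUnion_mem hE
  set U := ⋃ k, E k
  have hU' : parReducts U ∈ 𝔈 := h𝔈.reducts_mem U hU
  -- Elements of `A` outside `F` may now stay unchanged, so the free variables of `A` come into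
  -- play.
  have hfv : ∀ (c : ℕ), ∀ F ∈ 𝔈, ∀ A : Set (Expr κ), (fvSet A).Finite →
      (fvSet (reducts (ReflStep (RestrictTo (Bd c κ) F)) A)).Finite := fun c F hF A hA => by
    have := (h𝔈.finite_fv _ (h𝔈.reducts_mem F hF)).union hA
    rw [← fvSet_union] at this
    refine this.subset (fvSet_mono ?_)
    rintro y ⟨x, hx, ξ, ⟨hxF, hξ⟩ | rfl, hy⟩
    · exact .inl ⟨x, hxF, ξ, .inl hξ.par, hy⟩
    · exact .inr (Multiset.mem_singleton.1 hy ▸ hx)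
  obtain ⟨ε'', hε''⟩ := hS.splitRed_confluent
    (r := ReflStep (RestrictTo (Bd (∑ k, b k) κ) U))
    (r' := ReflStep (RestrictTo (Bd (2 ^ (n * ∑ k, b k)) κ) (parReducts U)))
    (fun k x ξ hx => hx.imp_left fun hx => ⟨Set.mem_iUnion.2 ⟨k, hx.1⟩, hx.2.mono
      (Finset.single_le_sum (fun _ _ => Nat.zero_le _) (Finset.mem_univ k))⟩)
    (fun x ξ hx => .inr rfl)
    (fun x ξ hx => by
      by_cases hxU : x ∈ U
      · obtain ⟨φ, hφ⟩ := Bd.exists_common_reduct hxU (ξ := ξ) fun k =>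
          reflStep_bd ((hx k).imp_left And.right)
        exact ⟨φ, fun k => (hφ k).mono fun _ _ _ h => .inl h⟩
      -- Outside `U` only the trivial step is allowed, so all the reducts are already equal to
      -- `{x}`.
      · refine ⟨{x}, fun k => ?_⟩
        rw [(hx k).resolve_left fun h => hxU h.1]
        exact .single (.inr rfl))
    (fun y => by
      -- Unchanged expressions contribute only `y` itself as an additional antecedent.
      refine ((finite_antecedents (2 ^ (n * ∑ k, b k)) κ (h𝔈.finite_fv _ hU') y).union
        (Set.finite_singleton y)).subset ?_
      rintro x ⟨φ, ⟨hx, hφ⟩ | rfl, hy⟩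
      · exact .inl ⟨hx, φ, hφ, hy⟩
      · exact .inr (Multiset.mem_singleton.1 hy).symm)
    (hfv _ _ hU) (hfv _ _ hU') hsplit
  exact ⟨ε'', fun k => ⟨_, _, hU', hε'' k⟩⟩

end Confluence

end Resource

/-! ### Transfer from `Fin n` to an arbitrary finite index set. -/

theorem lemma5p13 {S : Type*} [CommSemiring S] (hS : Resource.AdditiveSplitting S)
    (κ : Resource.Kind) (𝔈 : Set (Set (Resource.Expr κ)))
    (h𝔈 : Resource.IsReductionStructure (Resource.Par κ) 𝔈)
    (K : Type*) [Finite K] :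
    (∀ (ε : Resource.ResourceVector S κ) (ε' : K → Resource.ResourceVector S κ),
      (∀ k, Resource.BdRed 𝔈 ε (ε' k)) →
        ∃ ε'' : Resource.ResourceVector S κ, ∀ k, Resource.BdRed 𝔈 (ε' k) ε'') ∧
    (∀ (ε : Resource.ResourceVector S κ) (ε' : K → Resource.ResourceVector S κ),
      (∀ k, Resource.BdRedLoose 𝔈 ε (ε' k)) →
        ∃ ε'' : Resource.ResourceVector S κ, ∀ k, Resource.BdRedLoose 𝔈 (ε' k) ε'') := by
  obtain ⟨n, ⟨g⟩⟩ := Finite.exists_equiv_fin K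
  refine ⟨fun ε ε' h => ?_, fun ε ε' h => ?_⟩
  · obtain ⟨ε'', h''⟩ := Resource.bdRed_confluent hS h𝔈 fun i => h (g.symm i)
    exact ⟨ε'', fun k => by simpa using h'' (g k)⟩
  · obtain ⟨ε'', h''⟩ := Resource.bdRedLoose_confluent hS h𝔈 fun i => h (g.symm i)
    exact ⟨ε'', fun k => by simpa using h'' (g k)⟩
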